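/- Let $T$ be the group of translations of the Euclidean plane $\mathbb R^2$ and let $G_4=T\rtimes Z_4$ be the group generated by the translations and the rotations by multiples of $\pi/2$. For a group $G$ of plane isometries and a family $S$ of subsets of the plane, a set $K\subseteq\mathbb R^2$ is a $G$-covering of $S$ if for every $\gamma\in S$ there is $g\in G$ with $g\gamma\subseteq K$. Let $S_{\mathsf c}$ be the set of all (traces of) closed curves of length $2$, not necessarily simple, so that a unit segment traversed back and forth belongs to $S_{\mathsf c}$. Let $\beta=\cos(\pi/12)$ and let $\triangle_\beta$ be the closed (filled) equilateral triangle of height $\beta$ with horizontal bottom side, namely the one with vertices $(0,0)$, $(\tfrac{2}{\sqrt3}\beta,0)$ and $(\tfrac{1}{\sqrt3}\beta,\beta)$. Finally, let $$A'=(0,\tfrac{\pi}{12})\cup(\tfrac{3\pi}{12},\tfrac{5\pi}{12})\cup(\tfrac{7\pi}{12},\tfrac{9\pi}{12})\cup(\tfrac{11\pi}{12},\pi)$$ and let $S_{A'}$ be the set of all unit line segments whose slope angle (measured counterclockwise from the $x$-axis, in $[0,\pi)$) lies in $A'$. Then: (1) $\triangle_\beta$ is a minimal closed convex $G_4$-covering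 of $S_{\mathsf c}$: it is closed, convex and a $G_4$-covering of $S_{\mathsf c}$, and no proper closed subset of $\triangle_\beta$ (convex or not) is a $G_4$-covering of $S_{\mathsf c}$. (2) $\triangle_\beta$ is a smallest-area closed convex $T$-covering of $S_{A'}$: it is closed, convex and a $T$-covering of $S_{A'}$, and every closed convex $T$-covering of $S_{A'}$ has area at least that of $\triangle_\beta$. -/

import Mathlib

open Set MeasureTheory

/-! The Euclidean plane is `ℂ`, with its Lebesgue measure `volume` as area. -/

/-- The group `T` of translations of the plane. -/
def translationGroup : Subgroup (ℂ ≃ᵢ ℂ) where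
  carrier := {g | ∃ v : ℂ, ∀ z : ℂ, g z = z + v}
  one_mem' := ⟨0, fun z => by simp⟩
  mul_mem' := by
    rintro a b ⟨v, hv⟩ ⟨w, hw⟩
    exact ⟨w + v, fun z => by rw [IsometryEquiv.mul_apply, hw, hv]; ring⟩
  inv_mem' := by
    rintro a ⟨v, hv⟩
    refine ⟨-v, fun z => a.injective ?_⟩
    rw [IsometryEquiv.apply_inv_self, hv]; ring

/-- The group `G_k = T ⋊ Z_k` generated by the translations and the rotations by multiples of
`2π/k`: all maps `z ↦ e^{2πij/k} z + v` (intended for `k ≥ 1`). -/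
noncomputable def rotTransGroup (k : ℕ) : Subgroup (ℂ ≃ᵢ ℂ) where
  carrier := {g | ∃ (j : ℤ) (v : ℂ), ∀ z : ℂ,
    g z = Complex.exp (2 * Real.pi * j / k * Complex.I) * z + v}
  one_mem' := ⟨0, 0, fun z => by simp⟩
  mul_mem' := by
    rintro a b ⟨j, v, hv⟩ ⟨l, w, hw⟩
    refine ⟨j + l, Complex.exp (2 * Real.pi * j / k * Complex.I) * w + v, fun z => ?_⟩
    have h : Complex.exp (2 * Real.pi * ((j + l : ℤ) : ℂ) / k * Complex.I) =
        Complex.exp (2 * Real.pi * j / k * Complex.I) *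
          Complex.exp (2 * Real.pi * l / k * Complex.I) := by
      rw [← Complex.exp_add]; congr 1; push_cast; ring
    rw [IsometryEquiv.mul_apply, hw, hv, h]; ring
  inv_mem' := by
    rintro a ⟨j, v, hv⟩
    refine ⟨-j, -(Complex.exp (2 * Real.pi * ((-j : ℤ) : ℂ) / k * Complex.I) * v),
      fun z => a.injective ?_⟩
    have h : Complex.exp (2 * Real.pi * j / k * Complex.I) *
        Complex.exp (2 * Real.pi * ((-j : ℤ) : ℂ) / k * Complex.I) = 1 := by
      rw [← Complex.exp_add, ← Complex.exp_zero]; congr 1; push_cast; ring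
    rw [IsometryEquiv.apply_inv_self, hv]
    linear_combination (v - z) * h

/-- `K` is a `G`-covering of the family `S` of planar objects: every object of `S` is carried
into `K` by some transformation in `G`. -/
def IsCovering (G : Subgroup (ℂ ≃ᵢ ℂ)) (S : Set (Set ℂ)) (K : Set ℂ) : Prop :=
  ∀ γ ∈ S, ∃ g ∈ G, g '' γ ⊆ K

/-- `K` is a closed convex `G`-covering of `S` whose area is the smallest among all closed convex
`G`-coverings of `S`. -/
def IsSmallestAreaClosedConvexCovering
    (G : Subgroup (ℂ ≃ᵢ ℂ)) (S : Set (Set ℂ)) (K : Set ℂ) : Prop :=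
  IsClosed K ∧ Convex ℝ K ∧ IsCovering G S K ∧
    ∀ X : Set ℂ, IsClosed X → Convex ℝ X → IsCovering G S X → volume K ≤ volume X

/-- `K` is a closed convex `G`-covering of `S` that is minimal in the set-theoretic sense: no
proper closed subset of `K`, convex or not, is a `G`-covering of `S`. -/
def IsMinimalClosedConvexCovering
    (G : Subgroup (ℂ ≃ᵢ ℂ)) (S : Set (Set ℂ)) (K : Set ℂ) : Prop :=
  IsClosed K ∧ Convex ℝ K ∧ IsCovering G S K ∧
    ∀ P : Set ℂ, P ⊂ K → IsClosed P → ¬ IsCovering G S P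

/-- The set of all closed curves of length `2`, each given by its trace. Curves need not be
simple, so a unit segment traversed back and forth is one of them. -/
def closedCurvesLengthTwo : Set (Set ℂ) :=
  {Γ | ∃ γ : ℝ → ℂ, ContinuousOn γ (Icc 0 1) ∧ γ 0 = γ 1 ∧
    eVariationOn γ (Icc 0 1) = 2 ∧ Γ = γ '' Icc 0 1}

/-- The set of all unit segments whose slope (angle from the `x`-axis, in `[0, π)`) lies
in `A ⊆ [0, π)`. -/
def unitSegments (A : Set ℝ) : Set (Set ℂ) :=
  {s | ∃ p : ℂ, ∃ θ ∈ A, s = segment ℝ p (p + Complex.exp (θ * Complex.I))}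

/-- The height `β = cos (π/12)`. -/
noncomputable def heightBeta : ℝ := Real.cos (Real.pi / 12)

/-- The side length `(2/√3) β` of the equilateral triangle of height `β`. -/
noncomputable def sideBeta : ℝ := 2 / Real.sqrt 3 * heightBeta

/-- The (filled) equilateral triangle of height `β = cos (π/12)` with horizontal bottom side. -/
noncomputable def triangleBeta : Set ℂ :=
  convexHull ℝ {0, (⟨sideBeta, 0⟩ : ℂ), (⟨sideBeta / 2, heightBeta⟩ : ℂ)}

/-- The set of slopes
`A' = (0, π/12) ∪ (3π/12, 5π/12) ∪ (7π/12, 9π/12) ∪ (11π/12, π)`. -/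
noncomputable def slopesA' : Set ℝ :=
  Ioo 0 (Real.pi / 12) ∪ Ioo (3 * Real.pi / 12) (5 * Real.pi / 12) ∪
    Ioo (7 * Real.pi / 12) (9 * Real.pi / 12) ∪ Ioo (11 * Real.pi / 12) Real.pi

/-! ### Trigonometric constants -/

/-! Write `β` for `heightBeta`. A bounded set translates into the triangle as soon as its support
values in the three outer normal directions sum to at most `β`, since that sum is the height of the
smallest parallel triangle around it (`exists_translate_subset_triangleBeta`).

Covering closed curves. Over the four quarter-turned copies of a curve these sums add up to its six
widths in directions spaced by `π/6`. On unit vectors the six absolute projections total at most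
`4β`, so for length `2` the six widths total at most `4β` (`two_mul_sum_width_le`,
`sum_abs_sideForm_le`). Hence one of the four copies fits.

Minimality. Test curves are parallelograms of perimeter `2` whose side directions become too wide
for the triangle after a quarter turn. Such a parallelogram fits only up to translation, a half-turn
being a translation for it. For limiting directions it can touch all three sides, which fixes its
position (`add_mem_of_tight`). Sides of three families of these rigid parallelograms sweep out the
whole triangle (`triangleBeta_subset_of_isCovering`).

Smallest area. In a compact convex covering `X` take an inscribed triangle of maximal area `d/2`,
and erect on each side the triangle to the farthest point beyond it, of relative height `hᵢ ≤ 1`.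
Then `X` has area at least `(1 + h₀ + h₁ + h₂) d / 2`. Every direction is within `π/12` of the
closure of the prescribed slopes, so the segments in `X` force each side length times `β` to be at
most `(1 + hᵢ) d`. An isoperimetric inequality for three vectors (`sum_cross_le`) and an elementary
inequality in the `hᵢ` turn these three bounds into the area bound (`heightBeta_sq_div_le`). -/

lemma heightBeta_eq : heightBeta = (√3 + 1) * (√2 / 2) / 2 := by
  have h : Real.pi / 12 = Real.pi / 3 - Real.pi / 4 := by ring
  rw [heightBeta, h, Real.cos_sub, Real.cos_pi_div_three, Real.cos_pi_div_four,
    Real.sin_pi_div_three, Real.sin_pi_div_four]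
  ring

lemma sin_pi_div_twelve_eq : Real.sin (Real.pi / 12) = (√3 - 1) * (√2 / 2) / 2 := by
  have h : Real.pi / 12 = Real.pi / 3 - Real.pi / 4 := by ring
  rw [h, Real.sin_sub, Real.cos_pi_div_three, Real.cos_pi_div_four,
    Real.sin_pi_div_three, Real.sin_pi_div_four]
  ring

lemma sqrt_three_sq : √3 * √3 = 3 := Real.mul_self_sqrt (by norm_num)

lemma half_sqrt_two_sq : √2 / 2 * (√2 / 2) = 1 / 2 := by
  have := Real.mul_self_sqrt (show (0 : ℝ) ≤ 2 by norm_num)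
  linarith

lemma one_lt_sqrt_three : 1 < √3 := by
  rw [Real.lt_sqrt] <;> norm_num

lemma heightBeta_pos : 0 < heightBeta := by
  rw [heightBeta_eq]; positivity

lemma heightBeta_sq : heightBeta ^ 2 = (2 + √3) / 4 := by
  rw [heightBeta_eq]
  linear_combination (√3 + 1) ^ 2 / 4 * half_sqrt_two_sq + 1 / 8 * sqrt_three_sq

lemma sin_pi_div_twelve_pos : 0 < Real.sin (Real.pi / 12) :=
  Real.sin_pos_of_pos_of_lt_pi (by positivity) (by linarith [Real.pi_pos])

/-- Expressing all constants over `ℚ(√3)` as multiples of `heightBeta` reduces later trigonometric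
identities to `√3 * √3 = 3`. -/
lemma sin_pi_div_twelve_eq_mul : Real.sin (Real.pi / 12) = (2 - √3) * heightBeta := by
  rw [sin_pi_div_twelve_eq, heightBeta_eq]
  linear_combination √2 / 4 * sqrt_three_sq

lemma half_sqrt_two_eq_mul : √2 / 2 = (√3 - 1) * heightBeta := by
  rw [heightBeta_eq]
  linear_combination -√2 / 4 * sqrt_three_sq

lemma sqrt_three_mul_sideBeta : √3 * sideBeta = 2 * heightBeta := by
  rw [sideBeta]
  have := one_lt_sqrt_three
  field_simp

lemma sideBeta_pos : 0 < sideBeta := by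
  have := heightBeta_pos
  rw [sideBeta]; positivity

/-! ### The triangle as an intersection of three half-planes -/

/-- The inner products with the outer unit normals of the three sides of `triangleBeta`. -/
noncomputable def sideForm : Fin 3 → ℂ →L[ℝ] ℝ :=
  ![-Complex.imCLM, (√3 / 2) • Complex.reCLM + (1 / 2 : ℝ) • Complex.imCLM,
    (-(√3 / 2)) • Complex.reCLM + (1 / 2 : ℝ) • Complex.imCLM]

@[simp] lemma sideForm_zero_apply (z : ℂ) : sideForm 0 z = -z.im := by simp [sideForm]

@[simp] lemma sideForm_one_apply (z : ℂ) : sideForm 1 z = √3 / 2 * z.re + z.im / 2 := by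
  simp [sideForm]; ring

@[simp] lemma sideForm_two_apply (z : ℂ) : sideForm 2 z = -(√3 / 2) * z.re + z.im / 2 := by
  simp [sideForm]; ring

lemma mem_triangleBeta_iff {z : ℂ} : z ∈ triangleBeta ↔
    sideForm 0 z ≤ 0 ∧ sideForm 1 z ≤ heightBeta ∧ sideForm 2 z ≤ 0 := by
  have hs := sqrt_three_mul_sideBeta
  have hb := heightBeta_pos
  constructor
  · intro hz
    have hconv : Convex ℝ {z : ℂ | sideForm 0 z ≤ 0 ∧ sideForm 1 z ≤ heightBeta ∧
        sideForm 2 z ≤ 0} :=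
      ((convex_halfSpace_le (sideForm 0).toLinearMap.isLinear _).inter
        ((convex_halfSpace_le (sideForm 1).toLinearMap.isLinear _).inter
          (convex_halfSpace_le (sideForm 2).toLinearMap.isLinear _)))
    refine convexHull_min ?_ hconv hz
    rintro w (rfl | rfl | rfl) <;>
      simp only [mem_ofPred_eq, sideForm_zero_apply, sideForm_one_apply, sideForm_two_apply,
        Complex.zero_re, Complex.zero_im] <;>
      refine ⟨?_, ?_, ?_⟩ <;> nlinarith
  · rintro ⟨h0, h1, h2⟩
    simp only [sideForm_zero_apply, sideForm_one_apply, sideForm_two_apply] at h0 h1 h2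
    set K : Set ℂ := {0, (⟨sideBeta, 0⟩ : ℂ), (⟨sideBeta / 2, heightBeta⟩ : ℂ)} with hK
    have hmem : ∀ i : Fin 3, (![0, ⟨sideBeta, 0⟩, ⟨sideBeta / 2, heightBeta⟩] : Fin 3 → ℂ) i
        ∈ convexHull ℝ K := by
      intro i
      apply subset_convexHull
      fin_cases i <;> simp [hK]
    -- The weights are barycentric coordinates: distances to the opposite sides divided by the
    -- height.
    have := (convex_convexHull ℝ K).sum_mem (t := Finset.univ)
      (w := ![(heightBeta - (√3 / 2 * z.re + z.im / 2)) / heightBeta,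
        (√3 / 2 * z.re - z.im / 2) / heightBeta, z.im / heightBeta])
      (z := ![0, ⟨sideBeta, 0⟩, ⟨sideBeta / 2, heightBeta⟩]) ?_ ?_ (fun i _ => hmem i)
    · change z ∈ convexHull ℝ K
      convert this using 1
      have hsb : sideBeta = 2 / √3 * heightBeta := rfl
      have h3 := one_lt_sqrt_three
      apply Complex.ext
      · simp [Fin.sum_univ_three, hsb]
        field_simp
        ring
      · simp [Fin.sum_univ_three]
        field_simp
    · intro i _
      fin_cases i <;> simp <;> apply div_nonneg <;> linarith
    · simp [Fin.sum_univ_three]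
      field_simp
      ring

lemma isClosed_triangleBeta : IsClosed triangleBeta := by
  have : triangleBeta = {z | sideForm 0 z ≤ 0} ∩ ({z | sideForm 1 z ≤ heightBeta} ∩
      {z | sideForm 2 z ≤ 0}) := by
    ext z; exact mem_triangleBeta_iff
  rw [this]
  exact (isClosed_le (by fun_prop) (by fun_prop)).inter
    ((isClosed_le (by fun_prop) (by fun_prop)).inter (isClosed_le (by fun_prop) (by fun_prop)))

lemma convex_triangleBeta : Convex ℝ triangleBeta := convex_convexHull ℝ _

lemma sum_sideForm (z : ℂ) : sideForm 0 z + sideForm 1 z + sideForm 2 z = 0 := by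
  simp only [sideForm_zero_apply, sideForm_one_apply, sideForm_two_apply]; ring

lemma eq_zero_of_sideForm_nonpos {z : ℂ} (h : ∀ i, sideForm i z ≤ 0) : z = 0 := by
  have h0 := h 0
  have h1 := h 1
  have h2 := h 2
  simp only [sideForm_zero_apply, sideForm_one_apply, sideForm_two_apply] at h0 h1 h2
  have h3 := one_lt_sqrt_three
  have him : z.im = 0 := by nlinarith
  have hre : z.re = 0 := by rw [him] at h1 h2; nlinarith
  exact Complex.ext hre him

lemma exists_translate_subset_triangleBeta {Γ : Set ℂ} {z : Fin 3 → ℂ}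
    (hmax : ∀ i, ∀ x ∈ Γ, sideForm i x ≤ sideForm i (z i))
    (hz : sideForm 0 (z 0) + sideForm 1 (z 1) + sideForm 2 (z 2) ≤ heightBeta) :
    ∃ v : ℂ, ∀ x ∈ Γ, x + v ∈ triangleBeta := by
  set m := fun i => sideForm i (z i) with hm
  have h3 := one_lt_sqrt_three
  -- This translation makes sides `0` and `2` supporting; since the three forms sum to zero, the
  -- bound for side `1` is then exactly `hz`.
  set v : ℂ := ⟨2 / √3 * (m 0 / 2 + m 2), m 0⟩ with hv
  have hv0 : sideForm 0 v = -m 0 := by simp [hv]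
  have hv2 : sideForm 2 v = -m 2 := by
    simp only [sideForm_two_apply, hv]; field_simp; ring
  have hv1 : sideForm 1 v = m 0 + m 2 := by linarith [sum_sideForm v]
  refine ⟨v, fun x hx => mem_triangleBeta_iff.2 ?_⟩
  have a0 := hmax 0 x hx
  have a1 := hmax 1 x hx
  have a2 := hmax 2 x hx
  rw [map_add, map_add, map_add, hv0, hv1, hv2]
  simp only [hm] at *
  refine ⟨?_, ?_, ?_⟩ <;> linarith

/-! ### Widths of closed curves -/

lemma two_mul_abs_sub_le_sum_abs_sub {g : ℕ → ℝ} {n i j : ℕ} (h : g 0 = g n) (hi : i ≤ n)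
    (hj : j ≤ n) :
    2 * |g i - g j| ≤ ∑ l ∈ Finset.range n, |g (l + 1) - g l| := by
  wlog hij : i ≤ j generalizing i j
  · rw [abs_sub_comm]; exact this hj hi (by omega)
  have h1 := dist_le_Ico_sum_dist g (Nat.zero_le i)
  have h2 := dist_le_Ico_sum_dist g hij
  have h3 := dist_le_Ico_sum_dist g hj
  have e : ∑ l ∈ Finset.range n, |g (l + 1) - g l| =
      ∑ l ∈ Finset.Ico 0 n, dist (g l) (g (l + 1)) := by
    rw [Finset.range_eq_Ico]
    exact Finset.sum_congr rfl fun l _ => by rw [Real.dist_eq, abs_sub_comm]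
  rw [e, ← Finset.sum_Ico_consecutive _ (Nat.zero_le i) hi,
    ← Finset.sum_Ico_consecutive _ hij hj]
  rw [Real.dist_eq] at h1 h2 h3
  rw [← h] at h3
  have := abs_sub_le (g i) (g 0) (g j)
  rw [abs_sub_comm (g i) (g 0), abs_sub_comm (g 0) (g j)] at this
  linarith

/-- If the linear forms `φ k` satisfy `∑ |φ k z| ≤ C ‖z‖`, then the sum of the widths of a closed
curve in the directions `φ k` is at most `C / 2` times its length. -/
lemma two_mul_sum_width_le {ι : Type*} [Fintype ι] (φ : ι → ℂ →L[ℝ] ℝ) {C L : ℝ}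
    (hφ : ∀ z, ∑ k, |φ k z| ≤ C * ‖z‖) (hC : 0 ≤ C) (hL : 0 ≤ L) {γ : ℝ → ℂ} (hγ : γ 0 = γ 1)
    (hvar : eVariationOn γ (Icc 0 1) ≤ ENNReal.ofReal L) {a b : ι → ℝ}
    (ha : ∀ k, a k ∈ Icc (0 : ℝ) 1) (hb : ∀ k, b k ∈ Icc (0 : ℝ) 1) :
    2 * ∑ k, |φ k (γ (a k) - γ (b k))| ≤ C * L := by
  classical
  -- One partition containing every `a k` and `b k` serves all the forms at once: each closed
  -- coordinate sequence pays for its width twice, and the steps together are no longer than the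
  -- curve.
  set T : Finset ℝ := insert 0 (insert 1 (Finset.univ.image a ∪ Finset.univ.image b)) with hT
  have hTsub : ∀ x ∈ T, x ∈ Icc (0 : ℝ) 1 := by
    intro x hx
    simp only [hT, Finset.mem_insert, Finset.mem_union, Finset.mem_image, Finset.mem_univ,
      true_and] at hx
    rcases hx with rfl | rfl | ⟨k, rfl⟩ | ⟨k, rfl⟩
    · simp
    · simp
    · exact ha k
    · exact hb k
  have hpos : 0 < T.card := Finset.card_pos.2 ⟨0, by simp [hT]⟩
  obtain ⟨n, hn⟩ : ∃ n, T.card = n + 1 := ⟨T.card - 1, by omega⟩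
  set t := T.orderEmbOfFin hn with ht
  -- Clamping the index extends the enumeration to a monotone sequence on `ℕ`, constant from `n` on.
  set u : ℕ → ℝ := fun i => t ⟨min i n, by omega⟩ with hu
  have hmono : Monotone u := fun i j hij => t.monotone (by
    simp only [Fin.mk_le_mk]; omega)
  have hmem : ∀ i, u i ∈ Icc (0 : ℝ) 1 := fun i => hTsub _ (Finset.orderEmbOfFin_mem _ _ _)
  have hex : ∀ x ∈ T, ∃ i ≤ n, u i = x := by
    intro x hx
    have : x ∈ Set.range t := by rw [ht, Finset.range_orderEmbOfFin]; exact hx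
    obtain ⟨i, rfl⟩ := this
    refine ⟨i, by omega, ?_⟩
    simp only [hu]
    congr 1
    ext
    simp only []
    omega
  have hu0 : u 0 = 0 := by
    obtain ⟨i, -, hi⟩ := hex 0 (by simp [hT])
    exact le_antisymm (hi ▸ hmono (Nat.zero_le i)) (hmem 0).1
  have hun : u n = 1 := by
    obtain ⟨i, hin, hi⟩ := hex 1 (by simp [hT])
    exact le_antisymm (hmem n).2 (hi ▸ hmono hin)
  have hlen : ∑ l ∈ Finset.range n, ‖γ (u (l + 1)) - γ (u l)‖ ≤ L := by
    have := (eVariationOn.sum_le (f := γ) (n := n) hmono hmem).trans hvar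
    simp_rw [edist_dist, dist_eq_norm] at this
    rw [← ENNReal.ofReal_sum_of_nonneg (fun _ _ => norm_nonneg _)] at this
    exact (ENNReal.ofReal_le_ofReal_iff hL).1 this
  have hk : ∀ k, 2 * |φ k (γ (a k) - γ (b k))| ≤
      ∑ l ∈ Finset.range n, |φ k (γ (u (l + 1)) - γ (u l))| := by
    intro k
    obtain ⟨i, hin, hi⟩ := hex (a k) (by simp [hT])
    obtain ⟨j, hjn, hj⟩ := hex (b k) (by simp [hT])
    have := two_mul_abs_sub_le_sum_abs_sub (g := fun l => φ k (γ (u l)))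
      (by simp only [hu0, hun, hγ]) hin hjn
    simpa only [map_sub, ← hi, ← hj] using this
  calc 2 * ∑ k, |φ k (γ (a k) - γ (b k))|
      ≤ ∑ k, ∑ l ∈ Finset.range n, |φ k (γ (u (l + 1)) - γ (u l))| := by
        rw [Finset.mul_sum]; exact Finset.sum_le_sum fun k _ => hk k
    _ = ∑ l ∈ Finset.range n, ∑ k, |φ k (γ (u (l + 1)) - γ (u l))| := Finset.sum_comm
    _ ≤ ∑ l ∈ Finset.range n, C * ‖γ (u (l + 1)) - γ (u l)‖ :=
        Finset.sum_le_sum fun l _ => hφ _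
    _ ≤ C * L := by rw [← Finset.mul_sum]; exact mul_le_mul_of_nonneg_left hlen hC

lemma abs_add_add_abs_sub_eq (x y : ℝ) : |x + y| + |x - y| = 2 * max |x| |y| := by
  rcases abs_cases (x + y) with h | h <;> rcases abs_cases (x - y) with h' | h' <;>
  rcases abs_cases x with hx | hx <;> rcases abs_cases y with hy | hy <;>
  rcases max_cases |x| |y| with hm | hm <;> linarith

/-- The six directions are spaced by `π/6`; the sum is largest at odd multiples of `π/12`. After
passing to `|z.re|` and `|z.im|`, it is linear on each region cut out by the two maxima, and there
Cauchy–Schwarz suffices. -/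
lemma sum_abs_sideForm_le (z : ℂ) :
    ∑ i, |sideForm i z| + ∑ i, |sideForm i (Complex.I * z)| ≤ 4 * heightBeta * ‖z‖ := by
  have h3 := one_lt_sqrt_three
  have hss := sqrt_three_sq
  have hn : ‖z‖ ^ 2 = |z.re| ^ 2 + |z.im| ^ 2 := by
    rw [Complex.sq_norm, Complex.normSq_apply, sq_abs, sq_abs]; ring
  have e1 : ∑ i, |sideForm i z| = |z.im| + 2 * max |√3 / 2 * z.re| |z.im / 2| := by
    rw [Fin.sum_univ_three, ← abs_add_add_abs_sub_eq, sideForm_zero_apply, sideForm_one_apply,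
      sideForm_two_apply, abs_neg, ← abs_neg (√3 / 2 * z.re - z.im / 2),
      show -(√3 / 2 * z.re - z.im / 2) = -(√3 / 2) * z.re + z.im / 2 by ring]
    ring
  have e2 : ∑ i, |sideForm i (Complex.I * z)| = |z.re| + 2 * max |√3 / 2 * z.im| |z.re / 2| := by
    rw [Fin.sum_univ_three, ← abs_add_add_abs_sub_eq, sideForm_zero_apply, sideForm_one_apply,
      sideForm_two_apply, Complex.I_mul_re, Complex.I_mul_im, abs_neg,
      show √3 / 2 * -z.im + z.re / 2 = -(√3 / 2 * z.im - z.re / 2) by ring, abs_neg,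
      show -(√3 / 2) * -z.im + z.re / 2 = √3 / 2 * z.im + z.re / 2 by ring]
    ring
  rw [e1, e2]
  simp only [abs_mul, abs_div, abs_two, abs_of_pos (zero_lt_one.trans h3)]
  have hx := abs_nonneg z.re
  have hy := abs_nonneg z.im
  generalize |z.re| = x at *
  generalize |z.im| = y at *
  have hb := heightBeta_pos
  have hb2 := heightBeta_sq
  have hr := norm_nonneg z
  apply abs_le_of_sq_le_sq' _ (by positivity) |>.2
  have hexp : (4 * heightBeta * ‖z‖) ^ 2 = 4 * (2 + √3) * (x ^ 2 + y ^ 2) := by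
    rw [mul_pow, mul_pow, hb2, hn]; ring
  rw [hexp]
  rcases max_cases (√3 / 2 * x) (y / 2) with ⟨hm, hm'⟩ | ⟨hm, hm'⟩ <;>
  rcases max_cases (√3 / 2 * y) (x / 2) with ⟨hk, hk'⟩ | ⟨hk, hk'⟩ <;> rw [hm, hk]
  · nlinarith [mul_nonneg (show 0 ≤ 4 + 2 * √3 by positivity) (sq_nonneg (x - y))]
  · nlinarith [sq_nonneg (x - (2 + √3) * y)]
  · nlinarith [sq_nonneg (y - (2 + √3) * x)]
  · nlinarith
/-! ### The triangle covers all closed curves of length two -/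

lemma I_pow_mul_add_mem_rotTransGroup (j : ℕ) (v : ℂ) :
    ∃ g ∈ rotTransGroup 4, ∀ z, g z = Complex.I ^ j * z + v := by
  have h : Complex.exp (2 * Real.pi * ((j : ℤ) : ℂ) / (4 : ℕ) * Complex.I) = Complex.I ^ j := by
    have h' : 2 * Real.pi * ((j : ℤ) : ℂ) / (4 : ℕ) * Complex.I =
        j * (Real.pi / 2 * Complex.I) := by push_cast; ring
    rw [h', Complex.exp_nat_mul, Complex.exp_pi_div_two_mul_I]
  have hn : ‖Complex.I ^ j‖ = 1 := by simp
  refine ⟨(IsometryEquiv.mk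
    ((Equiv.mulLeft₀ (Complex.I ^ j) (by simp)).trans (Equiv.addRight v)) ?_), ⟨j, v, ?_⟩, ?_⟩
  · refine Isometry.of_dist_eq fun x y => ?_
    change dist (Complex.I ^ j * x + v) (Complex.I ^ j * y + v) = _
    rw [dist_add_right, dist_eq_norm, ← mul_sub, norm_mul, hn, one_mul, dist_eq_norm]
  · intro z; rw [h]; rfl
  · intro z; rfl

lemma exists_I_pow_of_mem_rotTransGroup {g : ℂ ≃ᵢ ℂ} (hg : g ∈ rotTransGroup 4) :
    ∃ w v : ℂ, (w = 1 ∨ w = -1 ∨ w = Complex.I ∨ w = -Complex.I) ∧ ∀ z, g z = w * z + v := by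
  obtain ⟨j, v, h⟩ := hg
  refine ⟨Complex.I ^ j, v, ?_, fun z => ?_⟩
  · obtain ⟨k, hk⟩ := Int.even_or_odd' j
    have h2 : Complex.I ^ (2 * k) = (-1) ^ k := by
      rw [zpow_mul]; congr 1; exact_mod_cast Complex.I_sq
    rcases hk with rfl | rfl
    · rw [h2]
      rcases Int.even_or_odd k with h | h <;> simp [h.neg_one_zpow]
    · rw [zpow_add₀ Complex.I_ne_zero, h2, zpow_one]
      rcases Int.even_or_odd k with h | h <;> simp [h.neg_one_zpow]
  · have h' : 2 * Real.pi * (j : ℂ) / (4 : ℕ) * Complex.I =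
        j * (Real.pi / 2 * Complex.I) := by push_cast; ring
    rw [h, h', Complex.exp_int_mul, Complex.exp_pi_div_two_mul_I]

lemma isCovering_triangleBeta_closedCurves :
    IsCovering (rotTransGroup 4) closedCurvesLengthTwo triangleBeta := by
  rintro Γ ⟨γ, hcont, hclosed, hvar, rfl⟩
  by_contra hno
  have hcomp : IsCompact (Icc (0 : ℝ) 1) := isCompact_Icc
  have hne : (Icc (0 : ℝ) 1).Nonempty := ⟨0, by simp⟩
  have hmax : ∀ (j : ℕ) (i : Fin 3), ∃ t ∈ Icc (0 : ℝ) 1, ∀ s ∈ Icc (0 : ℝ) 1,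
      sideForm i (Complex.I ^ j * γ s) ≤ sideForm i (Complex.I ^ j * γ t) := by
    intro j i
    obtain ⟨t, ht, h⟩ := hcomp.exists_isMaxOn hne
      (f := fun s => sideForm i (Complex.I ^ j * γ s)) (by fun_prop)
    exact ⟨t, ht, fun s hs => h hs⟩
  choose t ht htmax using hmax
  have hlt : ∀ j, heightBeta < ∑ i, sideForm i (Complex.I ^ j * γ (t j i)) := by
    intro j
    by_contra! hle
    rw [Fin.sum_univ_three] at hle
    obtain ⟨v, hv⟩ := exists_translate_subset_triangleBeta
      (Γ := (fun z => Complex.I ^ j * z) '' (γ '' Icc 0 1))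
      (z := fun i => Complex.I ^ j * γ (t j i))
      (by rintro i _ ⟨_, ⟨s, hs, rfl⟩, rfl⟩; exact htmax j i s hs) hle
    obtain ⟨g, hg, hgz⟩ := I_pow_mul_add_mem_rotTransGroup j v
    refine hno ⟨g, hg, ?_⟩
    rintro _ ⟨z, hz, rfl⟩
    rw [hgz]
    exact hv _ ⟨z, hz, rfl⟩
  -- Copies `j` and `j + 2` are opposite, so their support values pair into widths: three for `j =
  -- 0` and three for `j = 1`.
  have hb := heightBeta_pos
  have key := two_mul_sum_width_le
    (φ := (Sum.elim sideForm fun i => (sideForm i).comp (ContinuousLinearMap.mul ℝ ℂ Complex.I) :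
      Fin 3 ⊕ Fin 3 → ℂ →L[ℝ] ℝ))
    (C := 4 * heightBeta) (L := 2)
    (fun z => by rw [Fintype.sum_sum_type]; exact sum_abs_sideForm_le z)
    (by positivity) (by norm_num) hclosed (by rw [hvar]; norm_num)
    (a := Sum.elim (t 0) (t 1)) (b := Sum.elim (t 2) (t 3))
    (by rintro (i | i) <;> exact ht _ _) (by rintro (i | i) <;> exact ht _ _)
  have h0 : ∀ i, sideForm i (Complex.I ^ 0 * γ (t 0 i)) + sideForm i (Complex.I ^ 2 * γ (t 2 i)) ≤
      |sideForm i (γ (t 0 i) - γ (t 2 i))| := fun i => by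
    rw [Complex.I_sq, pow_zero, one_mul, neg_one_mul, ← map_add, ← sub_eq_add_neg]
    exact le_abs_self _
  have h1 : ∀ i, sideForm i (Complex.I ^ 1 * γ (t 1 i)) + sideForm i (Complex.I ^ 3 * γ (t 3 i)) ≤
      |sideForm i (Complex.I * (γ (t 1 i) - γ (t 3 i)))| := fun i => by
    rw [pow_one, ← map_add, show Complex.I * γ (t 1 i) + Complex.I ^ 3 * γ (t 3 i) =
      Complex.I * (γ (t 1 i) - γ (t 3 i)) by rw [pow_succ, Complex.I_sq]; ring]
    exact le_abs_self _
  have s0 := Finset.sum_le_sum fun i (_ : i ∈ Finset.univ) => h0 i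
  have s1 := Finset.sum_le_sum fun i (_ : i ∈ Finset.univ) => h1 i
  rw [Finset.sum_add_distrib] at s0 s1
  rw [Fintype.sum_sum_type] at key
  simp only [Sum.elim_inl, Sum.elim_inr, ContinuousLinearMap.comp_apply,
    ContinuousLinearMap.mul_apply'] at key
  linarith [hlt 0, hlt 1, hlt 2, hlt 3]

/-! ### The triangle covers the unit segments with slopes in `slopesA'` -/

/-- Since the numbers sum to zero, one sign class has at most one member, and its absolute value is
the sum of the positive parts. Thus a segment fits once its three widths do. -/
lemma sum_max_zero_le {x y z b : ℝ} (h : x + y + z = 0) (hx : |x| ≤ b) (hy : |y| ≤ b)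
    (hz : |z| ≤ b) : max 0 x + max 0 y + max 0 z ≤ b := by
  rw [abs_le] at hx hy hz
  rcases max_cases 0 x with hx' | hx' <;> rcases max_cases 0 y with hy' | hy' <;>
  rcases max_cases 0 z with hz' | hz' <;> linarith

lemma exists_translate_segment_subset_triangleBeta (p : ℂ) {e : ℂ}
    (he : ∀ i, |sideForm i e| ≤ heightBeta) :
    ∃ v : ℂ, ∀ x ∈ segment ℝ p (p + e), x + v ∈ triangleBeta := by
  have hmax : ∀ i, ∃ z : ℂ, (∀ x ∈ ({p, p + e} : Set ℂ), sideForm i x ≤ sideForm i z) ∧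
      sideForm i z = sideForm i p + max 0 (sideForm i e) := by
    intro i
    rcases le_total 0 (sideForm i e) with h | h
    · refine ⟨p + e, ?_, by rw [map_add, max_eq_right h]⟩
      rintro x (rfl | rfl) <;> simp [h]
    · refine ⟨p, ?_, by rw [max_eq_left h, add_zero]⟩
      rintro x (rfl | rfl) <;> simp [h]
  choose z hz hz' using hmax
  obtain ⟨v, hv⟩ := exists_translate_subset_triangleBeta hz (by
    rw [hz', hz', hz']
    linarith [sum_max_zero_le (sum_sideForm e) (he 0) (he 1) (he 2), sum_sideForm p])
  refine ⟨v, fun x hx => ?_⟩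
  have hconv : Convex ℝ {x | x + v ∈ triangleBeta} := convex_triangleBeta.translate_preimage_left v
  exact hconv.segment_subset (hv p (by simp)) (hv (p + e) (by simp)) hx

lemma addRight_mem_translationGroup (v : ℂ) :
    IsometryEquiv.addRight v ∈ translationGroup := ⟨v, fun _ => rfl⟩

lemma expI_re (θ : ℝ) : (Complex.exp (θ * Complex.I)).re = Real.cos θ :=
  Complex.exp_ofReal_mul_I_re θ

lemma expI_im (θ : ℝ) : (Complex.exp (θ * Complex.I)).im = Real.sin θ :=
  Complex.exp_ofReal_mul_I_im θ

lemma sideForm_zero_expI (θ : ℝ) :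
    sideForm 0 (Complex.exp (θ * Complex.I)) = Real.cos (θ + Real.pi / 2) := by
  rw [sideForm_zero_apply, expI_im, Real.cos_add_pi_div_two]

lemma sideForm_one_expI (θ : ℝ) :
    sideForm 1 (Complex.exp (θ * Complex.I)) = Real.cos (θ - Real.pi / 6) := by
  rw [sideForm_one_apply, expI_im, expI_re, Real.cos_sub, Real.cos_pi_div_six,
    Real.sin_pi_div_six]
  ring

lemma sideForm_two_expI (θ : ℝ) :
    sideForm 2 (Complex.exp (θ * Complex.I)) = -Real.cos (θ + Real.pi / 6) := by
  rw [sideForm_two_apply, expI_im, expI_re, Real.cos_add, Real.cos_pi_div_six,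
    Real.sin_pi_div_six]
  ring

lemma abs_cos_le_heightBeta {x : ℝ} (h1 : Real.pi / 12 ≤ x) (h2 : x ≤ 11 * Real.pi / 12) :
    |Real.cos x| ≤ heightBeta := by
  have hpi := Real.pi_pos
  rw [abs_le, heightBeta]
  constructor
  · rw [← Real.cos_pi_sub]
    exact Real.cos_le_cos_of_nonneg_of_le_pi (by linarith) (by linarith) (by linarith)
  · exact Real.cos_le_cos_of_nonneg_of_le_pi (by linarith) (by linarith) (by linarith)

lemma heightBeta_lt_cos {x : ℝ} (h : |x| < Real.pi / 12) : heightBeta < Real.cos x := by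
  have hpi := Real.pi_pos
  rw [heightBeta, ← Real.cos_abs x]
  exact Real.cos_lt_cos_of_nonneg_of_le_pi (abs_nonneg _) (by linarith) h

/-- The altitudes have slopes `π/6`, `π/2`, `5π/6`, and `slopesA'` stays at least `π/12` away from
them modulo `π`. The various rewritings shift the angle into `[π/12, 11π/12]`. -/
lemma abs_sideForm_expI_le {θ : ℝ} (h : θ ∈ slopesA') (i : Fin 3) :
    |sideForm i (Complex.exp (θ * Complex.I))| ≤ heightBeta := by
  have hpi := Real.pi_pos
  have e0 : |sideForm 0 (Complex.exp (θ * Complex.I))| = |Real.cos (θ - Real.pi / 2)| := by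
    rw [sideForm_zero_expI, Real.cos_add_pi_div_two, Real.cos_sub_pi_div_two, abs_neg]
  have e1 := congrArg abs (sideForm_one_expI θ)
  have e1' : |sideForm 1 (Complex.exp (θ * Complex.I))| = |Real.cos (Real.pi / 6 - θ)| := by
    rw [e1, ← Real.cos_neg]; ring_nf
  have e2 : |sideForm 2 (Complex.exp (θ * Complex.I))| = |Real.cos (θ + Real.pi / 6)| := by
    rw [sideForm_two_expI, abs_neg]
  have e0' : |sideForm 0 (Complex.exp (θ * Complex.I))| = |Real.cos (Real.pi / 2 - θ)| := by
    rw [e0, ← Real.cos_neg]; ring_nf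
  have e2' : |sideForm 2 (Complex.exp (θ * Complex.I))| = |Real.cos (θ + Real.pi / 6 - Real.pi)| := by
    rw [e2, Real.cos_sub_pi, abs_neg]
  rcases h with ((⟨h1, h2⟩ | ⟨h1, h2⟩) | ⟨h1, h2⟩) | ⟨h1, h2⟩ <;> fin_cases i
  · rw [Fin.zero_eta, e0']; exact abs_cos_le_heightBeta (by linarith) (by linarith)
  · rw [Fin.mk_one, e1']; exact abs_cos_le_heightBeta (by linarith) (by linarith)
  · change |sideForm 2 _| ≤ _
    rw [e2]; exact abs_cos_le_heightBeta (by linarith) (by linarith)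
  · rw [Fin.zero_eta, e0']; exact abs_cos_le_heightBeta (by linarith) (by linarith)
  · rw [Fin.mk_one, e1]; exact abs_cos_le_heightBeta (by linarith) (by linarith)
  · change |sideForm 2 _| ≤ _
    rw [e2]; exact abs_cos_le_heightBeta (by linarith) (by linarith)
  · rw [Fin.zero_eta, e0]; exact abs_cos_le_heightBeta (by linarith) (by linarith)
  · rw [Fin.mk_one, e1]; exact abs_cos_le_heightBeta (by linarith) (by linarith)
  · change |sideForm 2 _| ≤ _
    rw [e2]; exact abs_cos_le_heightBeta (by linarith) (by linarith)
  · rw [Fin.zero_eta, e0]; exact abs_cos_le_heightBeta (by linarith) (by linarith)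
  · rw [Fin.mk_one, e1]; exact abs_cos_le_heightBeta (by linarith) (by linarith)
  · change |sideForm 2 _| ≤ _
    rw [e2']; exact abs_cos_le_heightBeta (by linarith) (by linarith)

lemma isCovering_triangleBeta_unitSegments :
    IsCovering translationGroup (unitSegments slopesA') triangleBeta := by
  rintro _ ⟨p, θ, hθ, rfl⟩
  obtain ⟨v, hv⟩ := exists_translate_segment_subset_triangleBeta p (abs_sideForm_expI_le hθ)
  refine ⟨_, addRight_mem_translationGroup v, ?_⟩
  rintro _ ⟨x, hx, rfl⟩
  exact hv x hx
/-! ### Parallelograms as closed curves -/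

/-- The Lipschitz constant bounds the variation above, the distance of the endpoints below. -/
lemma eVariationOn_Icc_of_affine {γ : ℝ → ℂ} {a b : ℝ} (hab : a ≤ b) {u p : ℂ}
    (h : ∀ t ∈ Icc a b, γ t = u + t * p) :
    eVariationOn γ (Icc a b) = ENNReal.ofReal ((b - a) * ‖p‖) := by
  apply le_antisymm
  · have hlip : LipschitzOnWith ‖p‖₊ γ (Icc a b) := by
      refine LipschitzOnWith.of_dist_le_mul fun x hx y hy => ?_
      rw [h x hx, h y hy, dist_add_left, dist_eq_norm, ← sub_mul, norm_mul, ← Complex.ofReal_sub,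
        Complex.norm_real, Real.dist_eq, Real.norm_eq_abs, coe_nnnorm, mul_comm]
    have h1 := hlip.comp_eVariationOn_le (g := id) (s := Icc a b) (fun x hx => hx)
    have h2 : eVariationOn (id : ℝ → ℝ) (Icc a b) ≤ ENNReal.ofReal (b - a) := by
      have := (monotoneOn_id (α := ℝ) (s := Icc a b)).eVariationOn_eq
        (left_mem_Icc.2 hab) (right_mem_Icc.2 hab)
      rw [inter_self] at this
      exact this.le
    refine h1.trans ((mul_le_mul_right h2 _).trans (le_of_eq ?_))
    rw [mul_comm (b - a), ENNReal.ofReal_mul (norm_nonneg _), ofReal_norm]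
    rfl
  · have := eVariationOn.edist_le γ (left_mem_Icc.2 hab) (right_mem_Icc.2 hab)
    rw [h a (left_mem_Icc.2 hab), h b (right_mem_Icc.2 hab), edist_add_left, edist_dist,
      dist_eq_norm, ← sub_mul, norm_mul, ← Complex.ofReal_sub, Complex.norm_real,
      Real.norm_eq_abs, abs_sub_comm, abs_of_nonneg (sub_nonneg.2 hab)] at this
    exact this

/-- The closed curve running around the parallelogram `0, p, p + q, q`. -/
noncomputable def parallelogramCurve (p q : ℂ) (t : ℝ) : ℂ :=
  (max 0 (min 1 (4 * t)) : ℝ) * p + (max 0 (min 1 (4 * t - 1)) : ℝ) * q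
    - (max 0 (min 1 (4 * t - 2)) : ℝ) * p - (max 0 (min 1 (4 * t - 3)) : ℝ) * q

/-- Each clamp `max 0 (min 1 ·)` climbs from `0` to `1` on its own quarter of the interval and is
constant elsewhere. -/
lemma parallelogramCurve_of_mem {p q : ℂ} {t : ℝ} :
    (t ∈ Icc 0 (1 / 4) → parallelogramCurve p q t = 0 + t * (4 * p)) ∧
    (t ∈ Icc (1 / 4) (2 / 4) → parallelogramCurve p q t = (p - q) + t * (4 * q)) ∧
    (t ∈ Icc (2 / 4) (3 / 4) → parallelogramCurve p q t = (3 * p + q) + t * (-(4 * p))) ∧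
    (t ∈ Icc (3 / 4) 1 → parallelogramCurve p q t = 4 * q + t * (-(4 * q))) := by
  have hlo : ∀ x : ℝ, x ≤ 0 → max 0 (min 1 x) = 0 := fun x hx =>
    max_eq_left ((min_le_right _ _).trans hx)
  have hhi : ∀ x : ℝ, 1 ≤ x → max 0 (min 1 x) = 1 := fun x hx => by
    rw [min_eq_left hx, max_eq_right zero_le_one]
  have hmid : ∀ x : ℝ, 0 ≤ x → x ≤ 1 → max 0 (min 1 x) = x := fun x h0 h1 => by
    rw [min_eq_right h1, max_eq_right h0]
  unfold parallelogramCurve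
  refine ⟨?_, ?_, ?_, ?_⟩ <;> rintro ⟨h1, h2⟩
  · rw [hmid (4 * t) (by linarith) (by linarith), hlo (4 * t - 1) (by linarith),
      hlo (4 * t - 2) (by linarith), hlo (4 * t - 3) (by linarith)]
    push_cast; ring
  · rw [hhi (4 * t) (by linarith), hmid (4 * t - 1) (by linarith) (by linarith),
      hlo (4 * t - 2) (by linarith), hlo (4 * t - 3) (by linarith)]
    push_cast; ring
  · rw [hhi (4 * t) (by linarith), hhi (4 * t - 1) (by linarith),
      hmid (4 * t - 2) (by linarith) (by linarith), hlo (4 * t - 3) (by linarith)]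
    push_cast; ring
  · rw [hhi (4 * t) (by linarith), hhi (4 * t - 1) (by linarith),
      hhi (4 * t - 2) (by linarith), hmid (4 * t - 3) (by linarith) (by linarith)]
    push_cast; ring

lemma parallelogramCurve_image_mem {p q : ℂ} (hpq : ‖p‖ + ‖q‖ = 1) :
    parallelogramCurve p q '' Icc 0 1 ∈ closedCurvesLengthTwo := by
  refine ⟨_, ?_, ?_, ?_, rfl⟩
  · unfold parallelogramCurve; fun_prop
  · rw [parallelogramCurve_of_mem.1 (by norm_num), parallelogramCurve_of_mem.2.2.2 (by norm_num)]
    push_cast; ring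
  · have hI : Monotone (fun i : ℕ => (i : ℝ) / 4) := fun i j hij => by
      have : (i : ℝ) ≤ j := by exact_mod_cast hij
      simp only []
      linarith
    have hsum := eVariationOn.sum' (parallelogramCurve p q) hI (n := 4)
    simp only [Finset.sum_range_succ, Finset.sum_range_zero, zero_add] at hsum
    push_cast at hsum
    norm_num at hsum
    rw [← hsum, eVariationOn_Icc_of_affine (by norm_num) (fun t ht =>
        parallelogramCurve_of_mem.1 (by convert ht)),
      eVariationOn_Icc_of_affine (by norm_num) (fun t ht =>
        parallelogramCurve_of_mem.2.1 (by convert ht using 2; norm_num)),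
      eVariationOn_Icc_of_affine (by norm_num) (fun t ht =>
        parallelogramCurve_of_mem.2.2.1 (by convert ht using 2; norm_num)),
      eVariationOn_Icc_of_affine (by norm_num) (fun t ht =>
        parallelogramCurve_of_mem.2.2.2 (by convert ht)),
      ← ENNReal.ofReal_add (by positivity) (by positivity),
      ← ENNReal.ofReal_add (by positivity) (by positivity),
      ← ENNReal.ofReal_add (by positivity) (by positivity)]
    simp only [norm_neg, norm_mul, RCLike.norm_ofNat]
    rw [show (2 : ENNReal) = ENNReal.ofReal 2 by norm_num]
    congr 1
    linarith

/-- The two points are exchanged by the half-turn about the centre; tracking both later turns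
half-turn placements into translations. -/
lemma ofReal_mul_mem_parallelogramCurve {p q : ℂ} {c : ℝ} (hc : c ∈ Icc (0 : ℝ) 1) :
    c * p ∈ parallelogramCurve p q '' Icc 0 1 ∧
      p + q - c * p ∈ parallelogramCurve p q '' Icc 0 1 := by
  obtain ⟨h0, h1⟩ := hc
  refine ⟨⟨c / 4, ⟨by linarith, by linarith⟩, ?_⟩, ⟨(2 + c) / 4, ⟨by linarith, by linarith⟩, ?_⟩⟩
  · rw [parallelogramCurve_of_mem.1 ⟨by linarith, by linarith⟩]
    push_cast; ring
  · rw [parallelogramCurve_of_mem.2.2.1 ⟨by linarith, by linarith⟩]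
    push_cast; ring

/-! ### Minimality of the triangle -/

lemma abs_le_sum_max_zero {f : Fin 3 → ℝ} (h : f 0 + f 1 + f 2 = 0) (j : Fin 3) :
    |f j| ≤ max 0 (f 0) + max 0 (f 1) + max 0 (f 2) := by
  have h0 := le_max_left 0 (f 0)
  have h0' := le_max_right 0 (f 0)
  have h1 := le_max_left 0 (f 1)
  have h1' := le_max_right 0 (f 1)
  have h2 := le_max_left 0 (f 2)
  have h2' := le_max_right 0 (f 2)
  rw [abs_le]
  fin_cases j
  · change _ ≤ f 0 ∧ f 0 ≤ _; constructor <;> linarith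
  · change _ ≤ f 1 ∧ f 1 ≤ _; constructor <;> linarith
  · change _ ≤ f 2 ∧ f 2 ≤ _; constructor <;> linarith

lemma add_max_add_max_le {x y z b : ℝ} (h00 : x ≤ b) (h10 : x + y ≤ b) (h01 : x + z ≤ b)
    (h11 : x + y + z ≤ b) : x + max 0 y + max 0 z ≤ b := by
  rcases max_cases 0 y with hy | hy <;> rcases max_cases 0 z with hz | hz <;> linarith

/-- Adding the support values of the parallelogram over the three sides cancels `v` and leaves the
positive parts of the forms at `p` and at `q`; each of these two sums dominates the absolute value
of any single form. -/
lemma abs_sideForm_add_abs_sideForm_le {v p q : ℂ} (h00 : v ∈ triangleBeta)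
    (h10 : v + p ∈ triangleBeta) (h01 : v + q ∈ triangleBeta) (h11 : v + p + q ∈ triangleBeta)
    (j k : Fin 3) : |sideForm j p| + |sideForm k q| ≤ heightBeta := by
  rw [mem_triangleBeta_iff] at h00 h10 h01 h11
  simp only [map_add] at h10 h01 h11
  have a0 := add_max_add_max_le h00.1 h10.1 h01.1 h11.1
  have a1 := add_max_add_max_le h00.2.1 h10.2.1 h01.2.1 h11.2.1
  have a2 := add_max_add_max_le h00.2.2 h10.2.2 h01.2.2 h11.2.2
  have b1 := abs_le_sum_max_zero (f := fun i => sideForm i p) (sum_sideForm p) j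
  have b2 := abs_le_sum_max_zero (f := fun i => sideForm i q) (sum_sideForm q) k
  linarith [sum_sideForm v]

/-- The unit vectors such that a quarter turn makes the corresponding unit segment too wide for
`triangleBeta`. -/
def quarterTurnWide : Set ℂ :=
  {e | ‖e‖ = 1 ∧ ∃ i, heightBeta < |sideForm i (Complex.I * e)|}

lemma neg_mem_quarterTurnWide {e : ℂ} (he : e ∈ quarterTurnWide) : -e ∈ quarterTurnWide := by
  obtain ⟨h, i, hi⟩ := he
  exact ⟨by rwa [norm_neg], i, by rwa [mul_neg, map_neg, abs_neg]⟩

lemma neg_mem_closure_quarterTurnWide {e : ℂ} (he : e ∈ closure quarterTurnWide) :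
    -e ∈ closure quarterTurnWide :=
  map_mem_closure continuous_neg he fun _ => neg_mem_quarterTurnWide

lemma I_mul_expI (θ : ℝ) : Complex.I * Complex.exp (θ * Complex.I) =
    Complex.exp ((θ + Real.pi / 2 : ℝ) * Complex.I) := by
  rw [Complex.ofReal_add, add_mul, Complex.exp_add]
  push_cast
  rw [Complex.exp_pi_div_two_mul_I, mul_comm]

/-- A quarter turn moves `slopesA'` to within `π/12` of an altitude, where the width exceeds
`heightBeta`. -/
lemma expI_mem_quarterTurnWide {θ : ℝ} (h : θ ∈ slopesA') :
    Complex.exp (θ * Complex.I) ∈ quarterTurnWide := by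
  refine ⟨Complex.norm_exp_ofReal_mul_I θ, ?_⟩
  rw [I_mul_expI]
  rcases h with ((⟨h1, h2⟩ | ⟨h1, h2⟩) | ⟨h1, h2⟩) | ⟨h1, h2⟩
  · refine ⟨0, ?_⟩
    rw [sideForm_zero_expI, ← abs_neg, ← Real.cos_sub_pi]
    exact (heightBeta_lt_cos (by rw [abs_lt]; constructor <;> linarith)).trans_le (le_abs_self _)
  · refine ⟨2, ?_⟩
    rw [sideForm_two_expI, ← Real.cos_sub_pi]
    exact (heightBeta_lt_cos (by rw [abs_lt]; constructor <;> linarith)).trans_le (le_abs_self _)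
  · refine ⟨1, ?_⟩
    rw [sideForm_one_expI, ← abs_neg, ← Real.cos_sub_pi]
    exact (heightBeta_lt_cos (by rw [abs_lt]; constructor <;> linarith)).trans_le (le_abs_self _)
  · refine ⟨0, ?_⟩
    rw [sideForm_zero_expI, ← Real.cos_sub_two_pi]
    exact (heightBeta_lt_cos (by rw [abs_lt]; constructor <;> linarith)).trans_le (le_abs_self _)

lemma expI_mem_closure_quarterTurnWide {θ : ℝ} (h : θ ∈ closure slopesA') :
    Complex.exp (θ * Complex.I) ∈ closure quarterTurnWide :=
  map_mem_closure (f := fun θ : ℝ => Complex.exp (θ * Complex.I)) (by fun_prop) h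
    fun _ => expI_mem_quarterTurnWide

lemma mem_closure_slopesA' {θ : ℝ} (h : θ ∈ Icc 0 (Real.pi / 12) ∨
    θ ∈ Icc (3 * Real.pi / 12) (5 * Real.pi / 12) ∨ θ ∈ Icc (7 * Real.pi / 12) (9 * Real.pi / 12) ∨
    θ ∈ Icc (11 * Real.pi / 12) Real.pi) : θ ∈ closure slopesA' := by
  have hpi := Real.pi_pos
  simp only [slopesA', closure_union]
  rcases h with h | h | h | h
  · rw [← closure_Ioo (by linarith)] at h; exact Or.inl (Or.inl (Or.inl h))
  · rw [← closure_Ioo (by linarith)] at h; exact Or.inl (Or.inl (Or.inr h))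
  · rw [← closure_Ioo (by linarith)] at h; exact Or.inl (Or.inr h)
  · rw [← closure_Ioo (by linarith)] at h; exact Or.inr h

lemma expI_one : Complex.exp ((Real.pi / 12 : ℝ) * Complex.I) =
    ⟨heightBeta, Real.sin (Real.pi / 12)⟩ :=
  Complex.ext (expI_re _) (expI_im _)

lemma expI_three : Complex.exp ((3 * Real.pi / 12 : ℝ) * Complex.I) = ⟨√2 / 2, √2 / 2⟩ := by
  have h : 3 * Real.pi / 12 = Real.pi / 4 := by ring
  rw [h]
  exact Complex.ext ((expI_re _).trans Real.cos_pi_div_four)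
    ((expI_im _).trans Real.sin_pi_div_four)

lemma expI_five : Complex.exp ((5 * Real.pi / 12 : ℝ) * Complex.I) =
    ⟨Real.sin (Real.pi / 12), heightBeta⟩ := by
  have h : 5 * Real.pi / 12 = Real.pi / 2 - Real.pi / 12 := by ring
  rw [h]
  exact Complex.ext ((expI_re _).trans (Real.cos_pi_div_two_sub _))
    ((expI_im _).trans (Real.sin_pi_div_two_sub _))

lemma expI_pi_sub (θ : ℝ) : Complex.exp ((Real.pi - θ : ℝ) * Complex.I) =
    ⟨-Real.cos θ, Real.sin θ⟩ :=
  Complex.ext ((expI_re _).trans (Real.cos_pi_sub _)) ((expI_im _).trans (Real.sin_pi_sub _))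

lemma expI_eleven : Complex.exp ((11 * Real.pi / 12 : ℝ) * Complex.I) =
    ⟨-heightBeta, Real.sin (Real.pi / 12)⟩ := by
  have h : 11 * Real.pi / 12 = Real.pi - Real.pi / 12 := by ring
  rw [h, expI_pi_sub]; rfl

section Minimality

variable {P : Set ℂ}

lemma exists_parallelogram_subset (hcov : IsCovering (rotTransGroup 4) closedCurvesLengthTwo P)
    (hPK : P ⊆ triangleBeta) {e₁ e₂ : ℂ} (h₁ : e₁ ∈ quarterTurnWide) (h₂ : e₂ ∈ quarterTurnWide)
    {a : ℝ} (ha : a ∈ Icc (0 : ℝ) 1) :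
    ∃ v : ℂ, ∀ c ∈ Icc (0 : ℝ) 1, v + c * (a * e₁) ∈ P ∧
      v + (a * e₁ + (1 - a : ℝ) * e₂ - c * (a * e₁)) ∈ P := by
  obtain ⟨ha0, ha1⟩ := ha
  set p : ℂ := a * e₁ with hp
  set q : ℂ := (1 - a : ℝ) * e₂ with hq
  have hpq : ‖p‖ + ‖q‖ = 1 := by
    rw [hp, hq, norm_mul, norm_mul, h₁.1, h₂.1, Complex.norm_real, Complex.norm_real,
      Real.norm_of_nonneg ha0, Real.norm_of_nonneg (sub_nonneg.2 ha1)]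
    ring
  obtain ⟨g, hg, hgP⟩ := hcov _ (parallelogramCurve_image_mem hpq)
  obtain ⟨w, v, hw, hgw⟩ := exists_I_pow_of_mem_rotTransGroup hg
  have hmem : ∀ c ∈ Icc (0 : ℝ) 1, w * (c * p) + v ∈ P ∧ w * (p + q - c * p) + v ∈ P := by
    intro c hc
    rw [← hgw, ← hgw]
    exact ⟨hgP ⟨_, (ofReal_mul_mem_parallelogramCurve hc).1, rfl⟩,
      hgP ⟨_, (ofReal_mul_mem_parallelogramCurve hc).2, rfl⟩⟩
  -- After a quarter turn the sides, of lengths `a` and `1 - a`, have widths exceeding `heightBeta`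
  -- in total, for suitable sides `i` and `j` of the triangle.
  have hcontra : ∀ w : ℂ, (w = Complex.I ∨ w = -Complex.I) →
      ¬ ∀ c ∈ Icc (0 : ℝ) 1, w * (c * p) + v ∈ P ∧ w * (p + q - c * p) + v ∈ P := by
    intro w hw hmem
    obtain ⟨-, i, hi⟩ := h₁
    obtain ⟨-, j, hj⟩ := h₂
    have m0 := hmem 0 (by simp)
    have m1 := hmem 1 (by simp)
    have hv := abs_sideForm_add_abs_sideForm_le (v := v) (p := w * p) (q := w * q)
      (hPK (by simpa using m0.1)) (hPK (by simpa [add_comm] using m1.1))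
      (hPK (by simpa [add_comm] using m1.2))
      (hPK (by convert m0.2 using 1; push_cast; ring)) i j
    have habs : ∀ (k : Fin 3) (r : ℝ) (e : ℂ), |sideForm k (w * (r * e))| =
        |r| * |sideForm k (Complex.I * e)| := by
      intro k r e
      have : Complex.I * (r * e) = r • (Complex.I * e) := by
        rw [Complex.real_smul]; ring
      rcases hw with rfl | rfl
      · rw [this, map_smul, smul_eq_mul, abs_mul]
      · rw [neg_mul, map_neg, abs_neg, this, map_smul, smul_eq_mul, abs_mul]
    rw [hp, hq, habs, habs, abs_of_nonneg ha0, abs_of_nonneg (sub_nonneg.2 ha1)] at hv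
    rcases ha0.eq_or_lt with rfl | ha0
    · linarith
    · nlinarith
  rcases hw with rfl | rfl | hw
  · refine ⟨v, fun c hc => ?_⟩
    simpa only [one_mul, add_comm] using hmem c hc
  · refine ⟨v - (p + q), fun c hc => ?_⟩
    obtain ⟨h1, h2⟩ := hmem c hc
    constructor
    · convert h2 using 1; ring
    · convert h1 using 1; ring
  · exact absurd hmem (hcontra w hw)

lemma isCompact_triangleBeta : IsCompact triangleBeta :=
  Set.Finite.isCompact_convexHull ℝ (by simp)

/-- If a parallelogram with sides in limiting directions touches the three sides of the triangle,
then its first side is contained in every closed covering contained in the triangle. -/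
lemma add_mem_of_tight (hP : IsClosed P)
    (hcov : IsCovering (rotTransGroup 4) closedCurvesLengthTwo P)
    (hPK : P ⊆ triangleBeta) {e₁ e₂ : ℂ} (h₁ : e₁ ∈ closure quarterTurnWide)
    (h₂ : e₂ ∈ closure quarterTurnWide) {a : ℝ} (ha : a ∈ Icc (0 : ℝ) 1) {D : ℂ}
    {z : Fin 3 → ℂ}
    (hz : ∀ i, z i = 0 ∨ z i = a * e₁ ∨ z i = (1 - a : ℝ) * e₂ ∨
      z i = a * e₁ + (1 - a : ℝ) * e₂)
    (h0 : sideForm 0 (D + z 0) = 0) (h1 : sideForm 1 (D + z 1) = heightBeta)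
    (h2 : sideForm 2 (D + z 2) = 0) {c : ℝ} (hc : c ∈ Icc (0 : ℝ) 1) :
    D + c * (a * e₁) ∈ P := by
  obtain ⟨u₁, hu₁, hl₁⟩ := mem_closure_iff_seq_limit.1 h₁
  obtain ⟨u₂, hu₂, hl₂⟩ := mem_closure_iff_seq_limit.1 h₂
  choose v hv using fun n => exists_parallelogram_subset hcov hPK (hu₁ n) (hu₂ n) ha
  obtain ⟨w, -, φ, hφ, hlim⟩ := isCompact_triangleBeta.tendsto_subseq
    (x := v) (fun n => by simpa using hPK (hv n 0 (by simp)).1)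
  have hl₁' := hl₁.comp hφ.tendsto_atTop
  have hl₂' := hl₂.comp hφ.tendsto_atTop
  have hmem : ∀ c ∈ Icc (0 : ℝ) 1, w + c * (a * e₁) ∈ P ∧
      w + (a * e₁ + (1 - a : ℝ) * e₂ - c * (a * e₁)) ∈ P := by
    intro c hc
    constructor
    · exact hP.mem_of_tendsto (hlim.add ((hl₁'.const_mul (a : ℂ)).const_mul (c : ℂ)))
        (Filter.Eventually.of_forall fun n => (hv (φ n) c hc).1)
    · exact hP.mem_of_tendsto (hlim.add (((hl₁'.const_mul (a : ℂ)).add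
        (hl₂'.const_mul ((1 - a : ℝ) : ℂ))).sub ((hl₁'.const_mul (a : ℂ)).const_mul (c : ℂ))))
        (Filter.Eventually.of_forall fun n => (hv (φ n) c hc).2)
  have hvert : ∀ i, w + z i ∈ triangleBeta := by
    intro i
    have m0 := hmem 0 (by simp)
    have m1 := hmem 1 (by simp)
    rcases hz i with h | h | h | h <;> rw [h]
    · simpa using hPK m0.1
    · simpa using hPK m1.1
    · simpa using hPK m1.2
    · simpa using hPK m0.2
  -- Tightness at `D` makes all three forms nonpositive at `w - D`; as they sum to zero, the limit
  -- position is unique.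
  have hw : w - D = 0 := by
    apply eq_zero_of_sideForm_nonpos
    have k0 := (mem_triangleBeta_iff.1 (hvert 0)).1
    have k1 := (mem_triangleBeta_iff.1 (hvert 1)).2.1
    have k2 := (mem_triangleBeta_iff.1 (hvert 2)).2.2
    rw [map_add] at k0 k1 k2 h0 h1 h2
    intro i
    fin_cases i
    · change sideForm 0 (w - D) ≤ 0; rw [map_sub]; linarith
    · change sideForm 1 (w - D) ≤ 0; rw [map_sub]; linarith
    · change sideForm 2 (w - D) ≤ 0; rw [map_sub]; linarith
  rw [← sub_eq_zero.1 hw]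
  exact (hmem c hc).1

/-- The rays from the origin at angles `π/12` and `π/4` cut the triangle into three regions, each
swept by one family of tight parallelograms. All sides point in end directions of the slope
intervals. -/
lemma triangleBeta_subset_of_isCovering (hP : IsClosed P)
    (hcov : IsCovering (rotTransGroup 4) closedCurvesLengthTwo P)
    (hPK : P ⊆ triangleBeta) : triangleBeta ⊆ P := by
  intro x hx
  have hpi := Real.pi_pos
  have g1 : (⟨heightBeta, Real.sin (Real.pi / 12)⟩ : ℂ) ∈ closure quarterTurnWide := by
    rw [← expI_one]
    exact expI_mem_closure_quarterTurnWide (mem_closure_slopesA'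
      (Or.inl ⟨by linarith, by linarith⟩))
  have g3 : (⟨√2 / 2, √2 / 2⟩ : ℂ) ∈ closure quarterTurnWide := by
    rw [← expI_three]
    exact expI_mem_closure_quarterTurnWide (mem_closure_slopesA'
      (Or.inr (Or.inl ⟨by linarith, by linarith⟩)))
  have g5 : (⟨Real.sin (Real.pi / 12), heightBeta⟩ : ℂ) ∈ closure quarterTurnWide := by
    rw [← expI_five]
    exact expI_mem_closure_quarterTurnWide (mem_closure_slopesA'
      (Or.inr (Or.inl ⟨by linarith, by linarith⟩)))
  have g11 : (⟨-heightBeta, Real.sin (Real.pi / 12)⟩ : ℂ) ∈ closure quarterTurnWide := by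
    rw [← expI_eleven]
    exact expI_mem_closure_quarterTurnWide (mem_closure_slopesA'
      (Or.inr (Or.inr (Or.inr ⟨by linarith, by linarith⟩))))
  obtain ⟨h0, h1, h2⟩ := mem_triangleBeta_iff.1 hx
  simp only [sideForm_zero_apply, sideForm_one_apply, sideForm_two_apply] at h0 h1 h2
  have hb := heightBeta_pos
  have hd := sin_pi_div_twelve_pos
  have hdb := sin_pi_div_twelve_eq_mul
  have hm := half_sqrt_two_eq_mul
  have hs := sqrt_three_mul_sideBeta
  have hs0 := sideBeta_pos
  have hw := one_lt_sqrt_three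
  have hww := sqrt_three_sq
  have key : ∀ {a r : ℝ}, 0 ≤ r → r ≤ a → ∃ c ∈ Icc (0 : ℝ) 1, c * a = r := by
    intro a r hr hra
    rcases (hr.trans hra).eq_or_lt with rfl | ha
    · exact ⟨0, by simp, by linarith⟩
    · exact ⟨r / a, ⟨by positivity, (div_le_one ha).2 hra⟩, div_mul_cancel₀ _ ha.ne'⟩
  -- Lower region: from a point of the bottom side, a side at angle `π/12` reaches the right side
  -- and one at `11π/12` reaches the left side.
  rcases le_total (x.im * heightBeta) (x.re * Real.sin (Real.pi / 12)) with hA | hA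
  · obtain ⟨r, hr⟩ : ∃ r, r * Real.sin (Real.pi / 12) = x.im := ⟨_, div_mul_cancel₀ _ hd.ne'⟩
    obtain ⟨τ, hτ⟩ : ∃ τ, τ * sideBeta = x.re - r * heightBeta := ⟨_, div_mul_cancel₀ _ hs0.ne'⟩
    have hr0 : 0 ≤ r := by
      by_contra! h; nlinarith
    have hτ0 : 0 ≤ τ := by
      by_contra! h
      have : τ * sideBeta < 0 := mul_neg_of_neg_of_pos h hs0
      nlinarith
    have hsum : (r + τ) * heightBeta = √3 / 2 * x.re + x.im / 2 := by
      rw [← hr]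
      have : x.re = τ * sideBeta + r * heightBeta := by linarith
      rw [this, hdb]
      linear_combination -τ / 2 * hs
    have hsum1 : r + τ ≤ 1 := by
      by_contra! h; nlinarith
    obtain ⟨c, hc, hca⟩ := key (a := 1 - τ) hr0 (by linarith)
    have := add_mem_of_tight hP hcov hPK g1 g11 (a := 1 - τ) ⟨by linarith, by linarith⟩
      (D := ((τ * sideBeta : ℝ) : ℂ))
      (z := ![0, ((1 - τ : ℝ) : ℂ) * ⟨heightBeta, Real.sin (Real.pi / 12)⟩,
        ((1 - (1 - τ) : ℝ) : ℂ) * ⟨-heightBeta, Real.sin (Real.pi / 12)⟩])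
      (by intro i; fin_cases i <;> simp) (by simp)
      (by simp [hdb]; linear_combination τ / 2 * hs)
      (by simp [hdb]; linear_combination -τ / 2 * hs) hc
    convert this using 1
    rw [← mul_assoc, ← Complex.ofReal_mul, hca]
    apply Complex.ext
    · simp; linear_combination -hτ
    · simp; linear_combination -hr
  -- Middle region: one vertex is the origin and the opposite vertex `D` lies on the right side; the
  -- side traced runs from `D` at angle `π/4` downwards.
  rcases le_total x.im x.re with hB | hB
  · have hm0 : 0 < √2 / 2 := by positivity
    obtain ⟨α, hα⟩ : ∃ α, α * (√2 / 2) = x.re - x.im := ⟨_, div_mul_cancel₀ _ hm0.ne'⟩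
    obtain ⟨σ, hσ⟩ : ∃ σ, σ * (√2 / 2) = x.im - α * Real.sin (Real.pi / 12) :=
      ⟨_, div_mul_cancel₀ _ hm0.ne'⟩
    have hre : x.re = α * heightBeta + σ * (√2 / 2) := by
      linear_combination -hσ - hα + α * hm + α * hdb
    have him : x.im = α * Real.sin (Real.pi / 12) + σ * (√2 / 2) := by linarith
    have hα0 : 0 ≤ α := by
      by_contra! h; nlinarith
    have hσ0 : 0 ≤ σ := by
      by_contra! h
      rw [hre, him, hdb, hm] at hA
      have : 0 ≤ σ * ((√3 - 1) ^ 2 * heightBeta ^ 2) := by nlinarith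
      have h' : 0 < (√3 - 1) ^ 2 * heightBeta ^ 2 := by
        have : 0 < √3 - 1 := by linarith
        positivity
      nlinarith
    have hsum : (α + σ) * heightBeta = √3 / 2 * x.re + x.im / 2 := by
      rw [hre, him, hdb, hm]
      linear_combination -σ * heightBeta / 2 * hww
    have hsum1 : α + σ ≤ 1 := by
      by_contra! h; nlinarith
    obtain ⟨c, hc, hca⟩ := key (a := 1 - α) (r := 1 - α - σ) (by linarith) (by linarith)
    have := add_mem_of_tight hP hcov hPK (neg_mem_closure_quarterTurnWide g3)
      (neg_mem_closure_quarterTurnWide g1) (a := 1 - α) ⟨by linarith, by linarith⟩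
      (D := α * ⟨heightBeta, Real.sin (Real.pi / 12)⟩ + ((1 - α : ℝ) : ℂ) * ⟨√2 / 2, √2 / 2⟩)
      (z := ![((1 - α : ℝ) : ℂ) * -⟨√2 / 2, √2 / 2⟩ +
          ((1 - (1 - α) : ℝ) : ℂ) * -⟨heightBeta, Real.sin (Real.pi / 12)⟩, 0,
        ((1 - α : ℝ) : ℂ) * -⟨√2 / 2, √2 / 2⟩ +
          ((1 - (1 - α) : ℝ) : ℂ) * -⟨heightBeta, Real.sin (Real.pi / 12)⟩])
      (by intro i; fin_cases i <;> simp) (by simp)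
      (by simp [hdb, hm]; linear_combination (1 - α) * heightBeta / 2 * hww) (by simp) hc
    convert this using 1
    rw [← mul_assoc, ← Complex.ofReal_mul, hca]
    apply Complex.ext
    · simp; linear_combination hre
    · simp; linear_combination him
  -- Upper region: from a point of the left side, a side at angle `π/4` reaches the right side and
  -- one at `5π/12` downwards reaches the bottom.
  · have hm0 : 0 < √2 / 2 := by positivity
    obtain ⟨τ, hτ⟩ : ∃ τ, τ * sideBeta = (√3 + 1) * (x.im - x.re) :=
      ⟨_, div_mul_cancel₀ _ hs0.ne'⟩
    obtain ⟨r, hr⟩ : ∃ r, r * (√2 / 2) = x.re - τ * sideBeta / 2 :=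
      ⟨_, div_mul_cancel₀ _ hm0.ne'⟩
    have hre : x.re = r * (√2 / 2) + τ * sideBeta / 2 := by linarith
    have him : x.im = r * (√2 / 2) + √3 * τ * sideBeta / 2 := by
      linear_combination -hr - (√3 - 1) / 2 * hτ - (x.im - x.re) / 2 * hww
    have hτ0 : 0 ≤ τ := by
      by_contra! h
      have : τ * sideBeta < 0 := mul_neg_of_neg_of_pos h hs0
      nlinarith
    have hr0 : 0 ≤ r := by
      by_contra! h
      have : r * (√2 / 2) < 0 := mul_neg_of_neg_of_pos h hm0
      nlinarith
    have hsum : (r + τ) * heightBeta = √3 / 2 * x.re + x.im / 2 := by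
      rw [hre, him, hm]
      linear_combination -τ / 2 * hs - r * heightBeta / 2 * hww
    have hsum1 : r + τ ≤ 1 := by
      by_contra! h; nlinarith
    obtain ⟨c, hc, hca⟩ := key (a := 1 - τ) hr0 (by linarith)
    have := add_mem_of_tight hP hcov hPK g3 (neg_mem_closure_quarterTurnWide g5)
      (a := 1 - τ) ⟨by linarith, by linarith⟩
      (D := ⟨τ * sideBeta / 2, √3 * τ * sideBeta / 2⟩)
      (z := ![((1 - (1 - τ) : ℝ) : ℂ) * -⟨Real.sin (Real.pi / 12), heightBeta⟩,
        ((1 - τ : ℝ) : ℂ) * ⟨√2 / 2, √2 / 2⟩, 0])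
      (by intro i; fin_cases i <;> simp)
      (by simp; linear_combination -τ / 2 * hs)
      (by simp [hm]; linear_combination τ / 2 * hs + (1 - τ) * heightBeta / 2 * hww)
      (by simp; ring) hc
    convert this using 1
    rw [← mul_assoc, ← Complex.ofReal_mul, hca]
    apply Complex.ext
    · simp; linear_combination hre
    · simp; linear_combination him

end Minimality

lemma isMinimalClosedConvexCovering_triangleBeta :
    IsMinimalClosedConvexCovering (rotTransGroup 4) closedCurvesLengthTwo triangleBeta :=
  ⟨isClosed_triangleBeta, convex_triangleBeta, isCovering_triangleBeta_closedCurves,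
    fun _ hPK hP hcov => hPK.2 (triangleBeta_subset_of_isCovering hP hcov hPK.1)⟩
/-! ### Areas of triangles -/

/-- The cross product of two plane vectors. -/
def cross (z w : ℂ) : ℝ := z.re * w.im - z.im * w.re

@[fun_prop]
lemma Continuous.cross {X : Type*} [TopologicalSpace X] {f g : X → ℂ} (hf : Continuous f)
    (hg : Continuous g) : Continuous fun x => cross (f x) (g x) := by
  have := Complex.continuous_re
  have := Complex.continuous_im
  unfold _root_.cross; fun_prop

/-- The linear map `s + t i ↦ s p + t q`. -/
noncomputable def frameMap (p q : ℂ) : ℂ →ₗ[ℝ] ℂ :=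
  Complex.reLm.smulRight p + Complex.imLm.smulRight q

lemma frameMap_apply (p q z : ℂ) : frameMap p q z = z.re * p + z.im * q := by
  simp [frameMap]

lemma det_frameMap (p q : ℂ) : LinearMap.det (frameMap p q) = cross p q := by
  rw [← LinearMap.det_toMatrix Complex.basisOneI, Matrix.det_fin_two]
  simp [LinearMap.toMatrix_apply, frameMap_apply, cross]
  ring

lemma volume_open_standard_triangle :
    volume {z : ℂ | 0 < z.re ∧ 0 < z.im ∧ z.re + z.im < 1} = ENNReal.ofReal (1 / 2) := by
  have h := volume_regionBetween_eq_integral (μ := (volume : Measure ℝ)) (s := Ioo 0 1)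
    (f := fun _ => 0) (g := fun x => 1 - x)
    (integrableOn_const (by simp)) ((Continuous.integrableOn_Icc (by fun_prop)).mono_set
      Ioo_subset_Icc_self) measurableSet_Ioo (fun x hx => by simpa using hx.2.le)
  rw [← integral_Ioc_eq_integral_Ioo, ← intervalIntegral.integral_of_le zero_le_one] at h
  have hint : ∫ x in (0 : ℝ)..1, ((fun x => 1 - x) - fun _ => 0 : ℝ → ℝ) x = 1 / 2 := by
    simp only [Pi.sub_apply, sub_zero]
    rw [intervalIntegral.integral_sub (by simp) (by simp)]
    norm_num
  rw [hint] at h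
  rw [← h]
  have hset : {z : ℂ | 0 < z.re ∧ 0 < z.im ∧ z.re + z.im < 1} = Complex.measurableEquivRealProd ⁻¹'
      regionBetween (fun _ : ℝ => (0 : ℝ)) (fun x => 1 - x) (Ioo 0 1) := by
    ext z
    simp only [mem_ofPred_eq, mem_preimage, regionBetween, mem_Ioo,
      Complex.measurableEquivRealProd_apply]
    constructor
    · rintro ⟨h1, h2, h3⟩; exact ⟨⟨h1, by linarith⟩, h2, by linarith⟩
    · rintro ⟨⟨h1, -⟩, h2, h3⟩; exact ⟨h1, h2, by linarith⟩
  rw [hset]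
  exact Complex.volume_preserving_equiv_real_prod.measure_preimage_equiv _

/-- The open triangle with vertices `a`, `a + p`, `a + q`. -/
def openTriangle (a p q : ℂ) : Set ℂ :=
  (fun z => a + z) '' (frameMap p q '' {z : ℂ | 0 < z.re ∧ 0 < z.im ∧ z.re + z.im < 1})

lemma mem_openTriangle {a p q z : ℂ} : z ∈ openTriangle a p q ↔
    ∃ s t : ℝ, 0 < s ∧ 0 < t ∧ s + t < 1 ∧ z = a + (s * p + t * q) := by
  constructor
  · rintro ⟨_, ⟨w, ⟨h1, h2, h3⟩, rfl⟩, rfl⟩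
    exact ⟨w.re, w.im, h1, h2, h3, by simp only [frameMap_apply]⟩
  · rintro ⟨s, t, h1, h2, h3, rfl⟩
    exact ⟨_, ⟨⟨s, t⟩, ⟨h1, h2, h3⟩, rfl⟩, by simp only [frameMap_apply]⟩

lemma volume_openTriangle (a p q : ℂ) :
    volume (openTriangle a p q) = ENNReal.ofReal (|cross p q| / 2) := by
  rw [openTriangle, image_add_left, measure_preimage_add, Measure.addHaar_image_linearMap,
    volume_open_standard_triangle, det_frameMap, ← ENNReal.ofReal_mul (abs_nonneg _)]
  congr 1; ring

lemma convex_openTriangle (a p q : ℂ) : Convex ℝ (openTriangle a p q) := by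
  refine (Convex.linear_image ?_ _).translate _
  exact (convex_halfSpace_gt Complex.reLm.isLinear 0).inter
    ((convex_halfSpace_gt Complex.imLm.isLinear 0).inter
      (convex_halfSpace_lt (Complex.reLm + Complex.imLm).isLinear 1))

lemma openTriangle_subset {X : Set ℂ} (hX : Convex ℝ X) {a b c : ℂ} (ha : a ∈ X) (hb : b ∈ X)
    (hc : c ∈ X) : openTriangle a (b - a) (c - a) ⊆ X := by
  intro z hz
  obtain ⟨s, t, hs, ht, hst, rfl⟩ := mem_openTriangle.1 hz
  have := hX.sum_mem (t := Finset.univ) (w := ![1 - s - t, s, t]) (z := ![a, b, c])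
    (by intro i _; fin_cases i <;> simp <;> linarith) (by simp [Fin.sum_univ_three]; ring)
    (by intro i _; fin_cases i <;> simp [ha, hb, hc])
  convert this using 1
  simp [Fin.sum_univ_three]
  ring

lemma mem_closure_openTriangle (a p q : ℂ) {s t : ℝ} (hs : 0 ≤ s) (ht : 0 ≤ t)
    (hst : s + t ≤ 1) : a + (s * p + t * q) ∈ closure (openTriangle a p q) := by
  -- Approach the point from the centroid.
  have hsub : openSegment ℝ (a + (s * p + t * q)) (a + ((1 / 3 : ℝ) * p + (1 / 3 : ℝ) * q)) ⊆
      openTriangle a p q := by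
    rintro _ ⟨u, v, hu, hv, huv, rfl⟩
    refine mem_openTriangle.2 ⟨u * s + v * (1 / 3), u * t + v * (1 / 3), by positivity,
      by positivity, by nlinarith, ?_⟩
    have : (u : ℂ) + v = 1 := by exact_mod_cast huv
    simp only [Complex.real_smul]
    push_cast
    linear_combination a * this
  exact closure_mono hsub (segment_subset_closure_openSegment (left_mem_segment ℝ _ _))

lemma volume_triangleBeta_le : volume triangleBeta ≤ ENNReal.ofReal (heightBeta ^ 2 / √3) := by
  have hw := one_lt_sqrt_three
  have hs := sqrt_three_mul_sideBeta
  have hb := heightBeta_pos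
  have hs0 := sideBeta_pos
  set T := openTriangle 0 ⟨sideBeta, 0⟩ ⟨sideBeta / 2, heightBeta⟩ with hT
  have hsub : triangleBeta ⊆ closure T := by
    refine convexHull_min ?_ (convex_openTriangle _ _ _).closure
    have h0 := mem_closure_openTriangle 0 ⟨sideBeta, 0⟩ ⟨sideBeta / 2, heightBeta⟩
      le_rfl le_rfl (by norm_num : (0 : ℝ) + 0 ≤ 1)
    have h1 := mem_closure_openTriangle 0 ⟨sideBeta, 0⟩ ⟨sideBeta / 2, heightBeta⟩
      zero_le_one le_rfl (by norm_num : (1 : ℝ) + 0 ≤ 1)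
    have h2 := mem_closure_openTriangle 0 ⟨sideBeta, 0⟩ ⟨sideBeta / 2, heightBeta⟩
      le_rfl zero_le_one (by norm_num : (0 : ℝ) + 1 ≤ 1)
    rintro z (rfl | rfl | rfl)
    · simpa using h0
    · simpa using h1
    · simpa using h2
  calc volume triangleBeta ≤ volume (closure T) := measure_mono hsub
    _ ≤ volume (T ∪ frontier T) := measure_mono fun z hz => by
        by_cases h : z ∈ T
        · exact Or.inl h
        · exact Or.inr ⟨hz, fun h' => h (interior_subset h')⟩
    _ ≤ volume T + volume (frontier T) := measure_union_le _ _
    _ = ENNReal.ofReal (heightBeta ^ 2 / √3) := by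
        rw [(convex_openTriangle _ _ _).addHaar_frontier volume, add_zero, hT,
          volume_openTriangle]
        have : cross ⟨sideBeta, 0⟩ ⟨sideBeta / 2, heightBeta⟩ = sideBeta * heightBeta := by
          simp [cross]
        rw [this, abs_of_pos (by positivity)]
        congr 1
        field_simp
        linear_combination hs

/-- The three cross products are barycentric coordinates for `a, b, c`, scaled to sum to `d`. At
`P₀` the first is at most `0` and the others at most `d`, so those are nonnegative; likewise for
`P₁`. Sign patterns then separate the four triangles. -/
lemma volume_ge_of_triangles {X : Set ℂ} (hX : Convex ℝ X) {a b c P₀ P₁ P₂ : ℂ} {d h₀ h₁ h₂ : ℝ}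
    (ha : a ∈ X) (hb : b ∈ X) (hc : c ∈ X) (hP₀ : P₀ ∈ X) (hP₁ : P₁ ∈ X) (hP₂ : P₂ ∈ X)
    (hd : cross (b - a) (c - a) = d) (hd0 : 0 < d) (hh₀ : 0 ≤ h₀) (hh₁ : 0 ≤ h₁) (hh₂ : 0 ≤ h₂)
    (hle₀ : ∀ z ∈ X, cross (b - z) (c - z) ≤ d)
    (hle₁ : ∀ z ∈ X, cross (z - a) (c - a) ≤ d)
    (hle₂ : ∀ z ∈ X, cross (b - a) (z - a) ≤ d)
    (h0 : cross (b - P₀) (c - P₀) = -(h₀ * d)) (h1 : cross (P₁ - a) (c - a) = -(h₁ * d))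
    (h2 : cross (b - a) (P₂ - a) = -(h₂ * d)) :
    ENNReal.ofReal ((1 + h₀ + h₁ + h₂) * d / 2) ≤ volume X := by
  have hsum : ∀ z, cross (b - z) (c - z) + cross (z - a) (c - a) + cross (b - a) (z - a) = d := by
    intro z; rw [← hd]; simp only [cross, Complex.sub_re, Complex.sub_im]; ring
  set T := openTriangle a (b - a) (c - a) with hT
  set T₀ := openTriangle b (c - b) (P₀ - b) with hT₀
  set T₁ := openTriangle a (c - a) (P₁ - a) with hT₁
  set T₂ := openTriangle a (b - a) (P₂ - a) with hT₂
  have vT : volume T = ENNReal.ofReal (d / 2) := by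
    rw [hT, volume_openTriangle, hd, abs_of_pos hd0]
  have vT₀ : volume T₀ = ENNReal.ofReal (h₀ * d / 2) := by
    rw [hT₀, volume_openTriangle]
    have : cross (c - b) (P₀ - b) = -(h₀ * d) := by
      rw [← h0]; simp only [cross, Complex.sub_re, Complex.sub_im]; ring
    rw [this, abs_neg, abs_of_nonneg (by positivity)]
  have vT₁ : volume T₁ = ENNReal.ofReal (h₁ * d / 2) := by
    rw [hT₁, volume_openTriangle]
    have : cross (c - a) (P₁ - a) = h₁ * d := by
      rw [← neg_neg (h₁ * d), ← h1]; simp only [cross, Complex.sub_re, Complex.sub_im]; ring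
    rw [this, abs_of_nonneg (by positivity)]
  have vT₂ : volume T₂ = ENNReal.ofReal (h₂ * d / 2) := by
    rw [hT₂, volume_openTriangle, h2, abs_neg, abs_of_nonneg (by positivity)]
  have hpos : ∀ z ∈ T, 0 < cross (b - z) (c - z) ∧ 0 < cross (z - a) (c - a) ∧
      0 < cross (b - a) (z - a) := by
    intro z hz
    obtain ⟨s, t, hs, ht, hst, rfl⟩ := mem_openTriangle.1 hz
    have e1 : cross (a + (s * (b - a) + t * (c - a)) - a) (c - a) = s * d := by
      rw [← hd]; simp [cross]; ring
    have e2 : cross (b - a) (a + (s * (b - a) + t * (c - a)) - a) = t * d := by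
      rw [← hd]; simp [cross]; ring
    have := hsum (a + (s * (b - a) + t * (c - a)))
    rw [e1, e2] at this ⊢
    refine ⟨?_, by positivity, by positivity⟩
    nlinarith
  have g0 : ∀ z ∈ T₀, cross (b - z) (c - z) ≤ 0 ∧ 0 < cross (z - a) (c - a) ∧
      0 < cross (b - a) (z - a) := by
    intro z hz
    obtain ⟨s, t, hs, ht, hst, rfl⟩ := mem_openTriangle.1 hz
    have k := hsum P₀
    have k1 := hle₁ _ hP₀
    have k2 := hle₂ _ hP₀
    have e0 : cross (b - (b + (s * (c - b) + t * (P₀ - b))))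
        (c - (b + (s * (c - b) + t * (P₀ - b)))) = t * cross (b - P₀) (c - P₀) := by
      simp [cross]; ring
    have e1 : cross (b + (s * (c - b) + t * (P₀ - b)) - a) (c - a) =
        (1 - s - t) * d + t * cross (P₀ - a) (c - a) := by
      rw [← hd]; simp [cross]; ring
    have e2 : cross (b - a) (b + (s * (c - b) + t * (P₀ - b)) - a) =
        s * d + t * cross (b - a) (P₀ - a) := by
      rw [← hd]; simp [cross]; ring
    rw [e0, e1, e2, h0]
    have q1 : 0 ≤ cross (P₀ - a) (c - a) := by nlinarith
    have q2 : 0 ≤ cross (b - a) (P₀ - a) := by nlinarith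
    have : 0 < 1 - s - t := by linarith
    have : 0 ≤ t * (h₀ * d) := by positivity
    exact ⟨by linarith, by positivity, by positivity⟩
  have g1 : ∀ z ∈ T₁, 0 < cross (b - z) (c - z) ∧ cross (z - a) (c - a) ≤ 0 ∧
      0 < cross (b - a) (z - a) := by
    intro z hz
    obtain ⟨s, t, hs, ht, hst, rfl⟩ := mem_openTriangle.1 hz
    have k := hsum P₁
    have k0 := hle₀ _ hP₁
    have k2 := hle₂ _ hP₁
    have e0 : cross (b - (a + (s * (c - a) + t * (P₁ - a))))
        (c - (a + (s * (c - a) + t * (P₁ - a)))) =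
        (1 - s - t) * d + t * cross (b - P₁) (c - P₁) := by
      rw [← hd]; simp [cross]; ring
    have e1 : cross (a + (s * (c - a) + t * (P₁ - a)) - a) (c - a) =
        t * cross (P₁ - a) (c - a) := by
      simp [cross]; ring
    have e2 : cross (b - a) (a + (s * (c - a) + t * (P₁ - a)) - a) =
        s * d + t * cross (b - a) (P₁ - a) := by
      rw [← hd]; simp [cross]; ring
    rw [e0, e1, e2, h1]
    have q0 : 0 ≤ cross (b - P₁) (c - P₁) := by nlinarith
    have q2 : 0 ≤ cross (b - a) (P₁ - a) := by nlinarith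
    have : 0 < 1 - s - t := by linarith
    have : 0 ≤ t * (h₁ * d) := by positivity
    exact ⟨by positivity, by linarith, by positivity⟩
  have g2 : ∀ z ∈ T₂, cross (b - a) (z - a) ≤ 0 := by
    intro z hz
    obtain ⟨s, t, hs, ht, hst, rfl⟩ := mem_openTriangle.1 hz
    have e2 : cross (b - a) (a + (s * (b - a) + t * (P₂ - a)) - a) =
        t * cross (b - a) (P₂ - a) := by
      simp [cross]; ring
    rw [e2, h2]
    have : 0 ≤ t * (h₂ * d) := by positivity
    linarith
  have d01 : Disjoint T T₀ := disjoint_left.2 fun z hz hz' =>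
    absurd (hpos z hz).1 (g0 z hz').1.not_gt
  have d02 : Disjoint (T ∪ T₀) T₁ := disjoint_left.2 fun z hz hz' => by
    rcases hz with hz | hz
    · exact absurd (hpos z hz).2.1 (g1 z hz').2.1.not_gt
    · exact absurd (g0 z hz).2.1 (g1 z hz').2.1.not_gt
  have d03 : Disjoint (T ∪ T₀ ∪ T₁) T₂ := disjoint_left.2 fun z hz hz' => by
    rcases hz with (hz | hz) | hz
    · exact absurd (hpos z hz).2.2 (g2 z hz').not_gt
    · exact absurd (g0 z hz).2.2 (g2 z hz').not_gt
    · exact absurd (g1 z hz).2.2 (g2 z hz').not_gt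
  have hunion : volume (T ∪ T₀ ∪ T₁ ∪ T₂) = ENNReal.ofReal ((1 + h₀ + h₁ + h₂) * d / 2) := by
    -- Convexity gives null measurability even for the degenerate triangles with `hᵢ = 0`.
    rw [measure_union₀ ((convex_openTriangle _ _ _).nullMeasurableSet _) d03.aedisjoint,
      measure_union₀ ((convex_openTriangle _ _ _).nullMeasurableSet _) d02.aedisjoint,
      measure_union₀ ((convex_openTriangle _ _ _).nullMeasurableSet _) d01.aedisjoint,
      vT, vT₀, vT₁, vT₂, ← ENNReal.ofReal_add (by positivity) (by positivity),
      ← ENNReal.ofReal_add (by positivity) (by positivity),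
      ← ENNReal.ofReal_add (by positivity) (by positivity)]
    congr 1; ring
  rw [← hunion]
  refine measure_mono (union_subset (union_subset (union_subset ?_ ?_) ?_) ?_)
  · exact openTriangle_subset hX ha hb hc
  · exact openTriangle_subset hX hb hc hP₀
  · exact openTriangle_subset hX ha hc hP₁
  · exact openTriangle_subset hX ha hb hP₂
/-! ### The triangle has the smallest area -/

/-- The gaps between the closed slope intervals have length `π/6`, so some end direction is within
`π/12` of the normal to `q`, unless the normal itself is admissible. Testing the six end directions
suffices; by symmetry only `|q.re|` and `|q.im|` matter. -/
lemma heightBeta_sq_mul_le {q : ℂ} {τ : ℝ}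
    (h : ∀ θ ∈ slopesA', |cross (Complex.exp (θ * Complex.I)) q| ≤ τ) :
    heightBeta ^ 2 * (q.re ^ 2 + q.im ^ 2) ≤ τ ^ 2 := by
  have hpi := Real.pi_pos
  have hcl : ∀ θ ∈ closure slopesA', |cross (Complex.exp (θ * Complex.I)) q| ≤ τ := by
    have : IsClosed {θ : ℝ | |cross (Complex.exp (θ * Complex.I)) q| ≤ τ} :=
      isClosed_le (by fun_prop) (by fun_prop)
    exact fun θ hθ => closure_minimal (fun θ hθ => h θ hθ) this hθ
  have k1 := hcl _ (mem_closure_slopesA' (Or.inl ⟨by positivity, le_rfl⟩))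
  have k3 := hcl (3 * Real.pi / 12)
    (mem_closure_slopesA' (Or.inr (Or.inl ⟨by linarith, by linarith⟩)))
  have k5 := hcl (5 * Real.pi / 12)
    (mem_closure_slopesA' (Or.inr (Or.inl ⟨by linarith, by linarith⟩)))
  have k7 := hcl (Real.pi - 5 * Real.pi / 12)
    (mem_closure_slopesA' (Or.inr (Or.inr (Or.inl ⟨by linarith, by linarith⟩))))
  have k9 := hcl (Real.pi - 3 * Real.pi / 12)
    (mem_closure_slopesA' (Or.inr (Or.inr (Or.inl ⟨by linarith, by linarith⟩))))
  have k11 := hcl (Real.pi - Real.pi / 12)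
    (mem_closure_slopesA' (Or.inr (Or.inr (Or.inr ⟨by linarith, by linarith⟩))))
  have r3 := congrArg Complex.re expI_three
  have i3 := congrArg Complex.im expI_three
  have r5 := congrArg Complex.re expI_five
  have i5 := congrArg Complex.im expI_five
  rw [expI_re] at r3 r5
  rw [expI_im] at i3 i5
  simp only [cross, expI_re, expI_im, Real.cos_pi_sub, Real.sin_pi_sub] at k1 k3 k5 k7 k9 k11
  rw [r3, i3] at k3 k9
  rw [r5, i5] at k5 k7
  simp only [] at k3 k9 k5 k7
  rw [show Real.cos (Real.pi / 12) = heightBeta from rfl] at k1 k11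
  have hb := heightBeta_pos
  have hw := one_lt_sqrt_three
  have hww := sqrt_three_sq
  have hb2 := heightBeta_sq
  rw [sin_pi_div_twelve_eq_mul] at k1 k5 k7 k11
  rw [half_sqrt_two_eq_mul] at k3 k9
  rw [abs_le] at k1 k3 k5 k7 k9 k11
  have key : ∃ x y : ℝ, 0 ≤ x ∧ 0 ≤ y ∧ x ^ 2 + y ^ 2 = q.re ^ 2 + q.im ^ 2 ∧
      heightBeta * (x + (2 - √3) * y) ≤ τ ∧ heightBeta * ((√3 - 1) * (x + y)) ≤ τ ∧
      heightBeta * ((2 - √3) * x + y) ≤ τ := by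
    refine ⟨|q.im|, |q.re|, abs_nonneg _, abs_nonneg _, by rw [sq_abs, sq_abs, add_comm], ?_⟩
    rcases abs_cases q.im with ⟨hx, -⟩ | ⟨hx, -⟩ <;> rcases abs_cases q.re with ⟨hy, -⟩ | ⟨hy, -⟩ <;>
      rw [hx, hy] <;> refine ⟨?_, ?_, ?_⟩ <;> linarith
  obtain ⟨x, y, hx, hy, hxy, j1, j3, j5⟩ := key
  have hw2 : √3 < 2 := by nlinarith
  rw [← hxy]
  have fin : ∀ u : ℝ, 0 ≤ u → heightBeta * u ≤ τ → x ^ 2 + y ^ 2 ≤ u ^ 2 →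
      heightBeta ^ 2 * (x ^ 2 + y ^ 2) ≤ τ ^ 2 := by
    intro u hu h1 h2
    calc heightBeta ^ 2 * (x ^ 2 + y ^ 2) ≤ heightBeta ^ 2 * u ^ 2 := by gcongr
      _ = (heightBeta * u) ^ 2 := by ring
      _ ≤ τ ^ 2 := by gcongr
  rcases le_total (√3 * y) x with h1 | h1
  · refine fin _ (by nlinarith) j1 ?_
    have : 0 ≤ 2 * (2 - √3) * y * (x - √3 * y) := by
      apply mul_nonneg (mul_nonneg _ hy) <;> linarith
    nlinarith
  rcases le_total (√3 * x) y with h2 | h2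
  · refine fin _ (by nlinarith) j5 ?_
    have : 0 ≤ 2 * (2 - √3) * x * (y - √3 * x) := by
      apply mul_nonneg (mul_nonneg _ hx) <;> linarith
    nlinarith
  · refine fin _ (mul_nonneg (by linarith) (by linarith)) j3 ?_
    have h3 : 0 ≤ (√3 * y - x) * (√3 * x - y) := mul_nonneg (by linarith) (by linarith)
    have h4 : 0 ≤ (2 - √3) * ((√3 * y - x) * (√3 * x - y)) := mul_nonneg (by linarith) h3
    have h5 : ((√3 - 1) * (x + y)) ^ 2 =
        x ^ 2 + y ^ 2 + (2 - √3) * ((√3 * y - x) * (√3 * x - y)) := by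
      linear_combination √3 * x * y * hww
    linarith

/-- The difference is `2|z₀ + ωz₁ + ω²z₂|² + |z₀ + z₁ + z₂|²` with `ω` a primitive cube root of
unity. -/
lemma sum_cross_le (x₀ y₀ x₁ y₁ x₂ y₂ : ℝ) :
    2 * √3 * ((x₀ * y₁ - y₀ * x₁) + (x₁ * y₂ - y₁ * x₂) + (x₂ * y₀ - y₂ * x₀)) ≤
      3 * ((x₀ ^ 2 + y₀ ^ 2) + (x₁ ^ 2 + y₁ ^ 2) + (x₂ ^ 2 + y₂ ^ 2)) := by
  have hww := sqrt_three_sq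
  have h1 := sq_nonneg (x₀ - (x₁ + x₂) / 2 - √3 / 2 * (y₁ - y₂))
  have h2 := sq_nonneg (y₀ - (y₁ + y₂) / 2 + √3 / 2 * (x₁ - x₂))
  have h3 := sq_nonneg (x₀ + x₁ + x₂)
  have h4 := sq_nonneg (y₀ + y₁ + y₂)
  have e : √3 ^ 2 = 3 := by rw [sq]; exact hww
  ring_nf at h1 h2 h3 h4 ⊢
  rw [e] at h1 h2
  linarith

lemma three_mul_prod_one_add_le {x y z : ℝ} (hx : 0 ≤ x) (hy : 0 ≤ y) (hz : 0 ≤ z) (hx' : x ≤ 1)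
    (hy' : y ≤ 1) (hz' : z ≤ 1) :
    3 * ((1 + x) * (1 + y) * (1 + z)) ≤ (1 + x + y + z) * (3 + x + y + z) := by
  have a1 := mul_le_mul_of_nonneg_left (mul_le_one₀ hy' hz hz') hx
  have a2 := mul_le_mul_of_nonneg_left (mul_le_one₀ hx' hz hz') hy
  have a3 := mul_le_mul_of_nonneg_left (mul_le_one₀ hx' hy hy') hz
  linarith [sq_nonneg (x - y), sq_nonneg (y - z), sq_nonneg (x - z)]

lemma heightBeta_sq_div_le {p q : ℂ} {d h₀ h₁ h₂ : ℝ} (hd : cross p q = d) (hd0 : 0 < d)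
    (hh₀ : h₀ ∈ Icc (0 : ℝ) 1) (hh₁ : h₁ ∈ Icc (0 : ℝ) 1) (hh₂ : h₂ ∈ Icc (0 : ℝ) 1)
    (h0 : heightBeta ^ 2 * ((p - q).re ^ 2 + (p - q).im ^ 2) ≤ ((1 + h₀) * d) ^ 2)
    (h1 : heightBeta ^ 2 * (q.re ^ 2 + q.im ^ 2) ≤ ((1 + h₁) * d) ^ 2)
    (h2 : heightBeta ^ 2 * (p.re ^ 2 + p.im ^ 2) ≤ ((1 + h₂) * d) ^ 2) :
    heightBeta ^ 2 / √3 ≤ (1 + h₀ + h₁ + h₂) * d / 2 := by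
  obtain ⟨p0, p0'⟩ := hh₀
  obtain ⟨p1, p1'⟩ := hh₁
  obtain ⟨p2, p2'⟩ := hh₂
  have hb := heightBeta_pos
  have hw := one_lt_sqrt_three
  have hww := sqrt_three_sq
  obtain ⟨t₀, ht₀⟩ : ∃ t, t = 1 + h₀ := ⟨_, rfl⟩
  obtain ⟨t₁, ht₁⟩ : ∃ t, t = 1 + h₁ := ⟨_, rfl⟩
  obtain ⟨t₂, ht₂⟩ : ∃ t, t = 1 + h₂ := ⟨_, rfl⟩
  rw [← ht₀] at h0
  rw [← ht₁] at h1
  rw [← ht₂] at h2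
  have q0 : 0 < t₀ := by linarith
  have q1 : 0 < t₁ := by linarith
  have q2 : 0 < t₂ := by linarith
  have norm_le : ∀ (x y t : ℝ), 0 < t → heightBeta ^ 2 * (x ^ 2 + y ^ 2) ≤ (t * d) ^ 2 →
      heightBeta ^ 2 * ((x / t) ^ 2 + (y / t) ^ 2) ≤ d ^ 2 := by
    intro x y t ht h
    rw [div_pow, div_pow, ← add_div, ← mul_div_assoc, div_le_iff₀ (by positivity)]
    linarith
  have n0 := norm_le _ _ _ q0 h0
  have n1 := norm_le _ _ _ q1 h1
  have n2 := norm_le (-p.re) (-p.im) _ q2 (by rwa [neg_sq, neg_sq])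
  -- The side vectors `p - q`, `q`, `-p` have all cyclic cross products equal to `d`; divided by
  -- `tᵢ`, each has length at most `d / heightBeta`.
  have hS := sum_cross_le ((p - q).re / t₀) ((p - q).im / t₀) (q.re / t₁) (q.im / t₁)
    (-p.re / t₂) (-p.im / t₂)
  have hSeq : ((p - q).re / t₀ * (q.im / t₁) - (p - q).im / t₀ * (q.re / t₁)) +
      (q.re / t₁ * (-p.im / t₂) - q.im / t₁ * (-p.re / t₂)) +
      (-p.re / t₂ * ((p - q).im / t₀) - -p.im / t₂ * ((p - q).re / t₀)) =
      d * (t₀ + t₁ + t₂) / (t₀ * t₁ * t₂) := by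
    rw [← hd, cross, Complex.sub_re, Complex.sub_im]
    field_simp
    ring
  rw [hSeq] at hS
  have h9 : heightBeta ^ 2 * (2 * √3 * (d * (t₀ + t₁ + t₂) / (t₀ * t₁ * t₂))) ≤ 9 * d ^ 2 := by
    have := mul_le_mul_of_nonneg_left hS (sq_nonneg heightBeta)
    linarith
  have h10 : 2 * √3 * heightBeta ^ 2 * (t₀ + t₁ + t₂) ≤ 9 * d * (t₀ * t₁ * t₂) := by
    have e : heightBeta ^ 2 * (2 * √3 * (d * (t₀ + t₁ + t₂) / (t₀ * t₁ * t₂))) =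
        (2 * √3 * heightBeta ^ 2 * (t₀ + t₁ + t₂)) * d / (t₀ * t₁ * t₂) := by ring
    rw [e, div_le_iff₀ (by positivity)] at h9
    exact le_of_mul_le_mul_right (h9.trans_eq (by ring)) hd0
  have hprod : 3 * (t₀ * t₁ * t₂) ≤ (t₀ + t₁ + t₂ - 2) * (t₀ + t₁ + t₂) := by
    rw [ht₀, ht₁, ht₂]
    have := three_mul_prod_one_add_le p0 p1 p2 p0' p1' p2'
    linarith
  have h11 : 2 * √3 * heightBeta ^ 2 ≤ 3 * d * (t₀ + t₁ + t₂ - 2) := by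
    have hQ : 0 < t₀ * t₁ * t₂ := by positivity
    have b1 : 2 * √3 * heightBeta ^ 2 * (3 * (t₀ * t₁ * t₂)) ≤
        2 * √3 * heightBeta ^ 2 * ((t₀ + t₁ + t₂ - 2) * (t₀ + t₁ + t₂)) :=
      mul_le_mul_of_nonneg_left hprod (by positivity)
    have b2 := mul_le_mul_of_nonneg_right h10 (show 0 ≤ t₀ + t₁ + t₂ - 2 by linarith)
    refine le_of_mul_le_mul_right ?_ hQ
    linarith
  rw [div_le_iff₀ (by positivity)]
  have e : 1 + h₀ + h₁ + h₂ = t₀ + t₁ + t₂ - 2 := by linarith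
  rw [e]
  have := mul_le_mul_of_nonneg_right h11 (show 0 ≤ √3 by positivity)
  have e2 : 2 * √3 * heightBeta ^ 2 * √3 = 6 * heightBeta ^ 2 := by
    linear_combination 2 * heightBeta ^ 2 * hww
  rw [e2] at this
  linarith

lemma cross_swap (z w : ℂ) : cross z w = -cross w z := by simp only [cross]; ring

/-- By Cramer's rule, the cross products with two independent vectors determine the point. -/
lemma isBounded_of_cross_le {X : Set ℂ} {z w e e' : ℂ} {C : ℝ} (hne : cross e e' ≠ 0)
    (h : ∀ x ∈ X, |cross e (x - z)| ≤ C) (h' : ∀ x ∈ X, |cross e' (x - w)| ≤ C) :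
    Bornology.IsBounded X := by
  rw [isBounded_iff_forall_norm_le]
  refine ⟨((C + |cross e z|) * ‖e'‖ + (C + |cross e' w|) * ‖e‖) / |cross e e'|, fun x hx => ?_⟩
  rw [le_div_iff₀ (abs_pos.2 hne)]
  have e1 : cross e x = cross e (x - z) + cross e z := by simp [cross]; ring
  have e2 : cross e' x = cross e' (x - w) + cross e' w := by simp [cross]; ring
  have b1 : |cross e x| ≤ C + |cross e z| := by
    rw [e1]; exact (abs_add_le _ _).trans (by linarith [h x hx])
  have b2 : |cross e' x| ≤ C + |cross e' w| := by
    rw [e2]; exact (abs_add_le _ _).trans (by linarith [h' x hx])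
  have e3 : (cross e e' : ℂ) * x = cross e x * e' - cross e' x * e := by
    apply Complex.ext <;> simp [cross] <;> ring
  calc ‖x‖ * |cross e e'| = ‖(cross e e' : ℂ) * x‖ := by
        rw [norm_mul, Complex.norm_real, Real.norm_eq_abs, mul_comm]
    _ ≤ ‖(cross e x : ℂ) * e'‖ + ‖(cross e' x : ℂ) * e‖ := by rw [e3]; exact norm_sub_le _ _
    _ ≤ _ := by
        rw [norm_mul, norm_mul, Complex.norm_real, Complex.norm_real, Real.norm_eq_abs,
          Real.norm_eq_abs]
        gcongr

lemma exists_mem_add_mem {X : Set ℂ} (hcov : IsCovering translationGroup (unitSegments slopesA') X)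
    {θ : ℝ} (hθ : θ ∈ slopesA') : ∃ z ∈ X, z + Complex.exp (θ * Complex.I) ∈ X := by
  obtain ⟨g, ⟨v, hg⟩, hX⟩ := hcov _ ⟨0, θ, hθ, rfl⟩
  refine ⟨g 0, hX ⟨0, left_mem_segment _ _ _, rfl⟩, ?_⟩
  have := hX ⟨_, right_mem_segment ℝ 0 (0 + Complex.exp (θ * Complex.I)), rfl⟩
  rwa [hg, zero_add, add_comm, ← zero_add v, ← hg 0] at this

lemma volume_ge_of_isCovering {X : Set ℂ} (hXc : IsClosed X) (hX : Convex ℝ X)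
    (hcov : IsCovering translationGroup (unitSegments slopesA') X) :
    ENNReal.ofReal (heightBeta ^ 2 / √3) ≤ volume X := by
  have hpi := Real.pi_pos
  -- Either one inscribed triangle is already large enough, or all are bounded in area; then two
  -- nonparallel segments in `X` force compactness, and a maximal triangle exists.
  by_cases hbig : ∃ a ∈ X, ∃ b ∈ X, ∃ c ∈ X, 2 * (heightBeta ^ 2 / √3) ≤ cross (b - a) (c - a)
  · obtain ⟨a, ha, b, hb, c, hc, h⟩ := hbig
    calc ENNReal.ofReal (heightBeta ^ 2 / √3)
        ≤ ENNReal.ofReal (|cross (b - a) (c - a)| / 2) :=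
          ENNReal.ofReal_le_ofReal (by linarith [le_abs_self (cross (b - a) (c - a))])
      _ = volume (openTriangle a (b - a) (c - a)) := (volume_openTriangle _ _ _).symm
      _ ≤ volume X := measure_mono (openTriangle_subset hX ha hb hc)
  push Not at hbig
  obtain ⟨z, hz, hz'⟩ := exists_mem_add_mem hcov (θ := Real.pi / 24)
    (Or.inl (Or.inl (Or.inl ⟨by linarith, by linarith⟩)))
  obtain ⟨w, hw, hw'⟩ := exists_mem_add_mem hcov (θ := Real.pi / 3)
    (Or.inl (Or.inl (Or.inr ⟨by linarith, by linarith⟩)))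
  set e := Complex.exp ((Real.pi / 24 : ℝ) * Complex.I) with he
  set e' := Complex.exp ((Real.pi / 3 : ℝ) * Complex.I) with he'
  have hne : cross e e' ≠ 0 := by
    have : cross e e' = Real.sin (Real.pi / 3 - Real.pi / 24) := by
      rw [Real.sin_sub, cross, he, he', expI_re, expI_re, expI_im, expI_im]; ring
    rw [this]
    exact (Real.sin_pos_of_pos_of_lt_pi (by linarith) (by linarith)).ne'
  have habs : ∀ a ∈ X, ∀ b ∈ X, ∀ c ∈ X, |cross (b - a) (c - a)| ≤ 2 * (heightBeta ^ 2 / √3) := by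
    intro a ha b hb c hc
    rw [abs_le']
    exact ⟨(hbig a ha b hb c hc).le, by
      rw [← cross_swap]; exact (hbig a ha c hc b hb).le⟩
  have hcomp : IsCompact X := Metric.isCompact_of_isClosed_isBounded hXc
    (isBounded_of_cross_le hne
      (fun x hx => by simpa using habs z hz _ hz' x hx)
      (fun x hx => by simpa using habs w hw _ hw' x hx))
  obtain ⟨⟨a, b, c⟩, ⟨ha, hb, hc⟩, hmax⟩ := (hcomp.prod (hcomp.prod hcomp)).exists_isMaxOn
    ⟨(z, z, z), hz, hz, hz⟩ (f := fun x : ℂ × ℂ × ℂ => cross (x.2.1 - x.1) (x.2.2 - x.1))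
    (Continuous.continuousOn (by fun_prop))
  have hle : ∀ x ∈ X, ∀ y ∈ X, ∀ v ∈ X, cross (y - x) (v - x) ≤ cross (b - a) (c - a) :=
    fun x hx y hy v hv => hmax (a := (x, y, v)) ⟨hx, hy, hv⟩
  obtain ⟨d, hd⟩ : ∃ d, cross (b - a) (c - a) = d := ⟨_, rfl⟩
  rw [hd] at hle
  have hd0 : 0 < d := by
    by_contra! hd0
    have hzero : ∀ x ∈ X, ∀ y ∈ X, ∀ v ∈ X, cross (y - x) (v - x) = 0 := fun x hx y hy v hv =>
      le_antisymm ((hle x hx y hy v hv).trans hd0) (by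
        rw [cross_swap, neg_nonneg]; exact (hle x hx v hv y hy).trans hd0)
    have k1 := hzero z hz _ hz' w hw
    have k2 := hzero z hz _ hz' _ hw'
    apply hne
    calc cross e e' = cross (z + e - z) (w + e' - z) - cross (z + e - z) (w - z) := by
          simp [cross]; ring
      _ = 0 := by rw [k1, k2, sub_zero]
  -- Farthest point beyond a side: maximality of `d` bounds its relative height by `1`.
  have hmin : ∀ f : ℂ → ℝ, Continuous f → (∃ x ∈ X, f x = 0) → (∀ x ∈ X, -d ≤ f x) →
      ∃ P ∈ X, ∃ h ∈ Icc (0 : ℝ) 1, f P = -(h * d) ∧ ∀ x ∈ X, -(h * d) ≤ f x := by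
    rintro f hf ⟨x₀, hx₀, hfx₀⟩ hfd
    obtain ⟨P, hP, hPmin⟩ := hcomp.exists_isMinOn ⟨z, hz⟩ hf.continuousOn
    have hPd : -(-f P / d * d) = f P := by field_simp
    refine ⟨P, hP, -f P / d, ⟨div_nonneg ?_ hd0.le, (div_le_one hd0).2 ?_⟩, hPd.symm,
      fun x hx => hPd.le.trans (hPmin hx)⟩
    · have : f P ≤ f x₀ := hPmin hx₀
      linarith
    · linarith [hfd P hP]
  obtain ⟨P₀, hP₀, h₀, hh₀, hf₀, hl₀⟩ := hmin (fun x => cross (b - x) (c - x)) (by fun_prop)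
    ⟨b, hb, by simp [cross]⟩ (fun x hx => by
      have := hle x hx c hc b hb
      rw [cross_swap]; linarith)
  obtain ⟨P₁, hP₁, h₁, hh₁, hf₁, hl₁⟩ := hmin (fun x => cross (x - a) (c - a)) (by fun_prop)
    ⟨a, ha, by simp [cross]⟩ (fun x hx => by
      have := hle a ha c hc x hx
      rw [cross_swap]; linarith)
  obtain ⟨P₂, hP₂, h₂, hh₂, hf₂, hl₂⟩ := hmin (fun x => cross (b - a) (x - a)) (by fun_prop)
    ⟨a, ha, by simp [cross]⟩ (fun x hx => by
      have := hle a ha x hx b hb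
      rw [cross_swap]; linarith)
  refine le_trans (ENNReal.ofReal_le_ofReal ?_) (volume_ge_of_triangles hX ha hb hc hP₀ hP₁ hP₂
    hd hd0 hh₀.1 hh₁.1 hh₂.1 (fun x hx => hle x hx b hb c hc) (fun x hx => hle a ha x hx c hc)
    (fun x hx => hle a ha b hb x hx) hf₀ hf₁ hf₂)
  -- On `X` each scaled coordinate ranges within `[-(hᵢ * d), d]`, so it changes by at most `(1 +
  -- hᵢ) * d` along a unit segment in `X`.
  refine heightBeta_sq_div_le hd hd0 hh₀ hh₁ hh₂ (heightBeta_sq_mul_le fun θ hθ => ?_)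
    (heightBeta_sq_mul_le fun θ hθ => ?_) (heightBeta_sq_mul_le fun θ hθ => ?_) <;>
  obtain ⟨x, hx, hx'⟩ := exists_mem_add_mem hcov hθ <;>
  set u := Complex.exp (θ * Complex.I) <;> rw [abs_le]
  · have e : cross u (b - a - (c - a)) =
        cross (b - (x + u)) (c - (x + u)) - cross (b - x) (c - x) := by
      simp [cross]; ring
    rw [e]
    constructor <;> linarith [hl₀ x hx, hl₀ _ hx', hle x hx b hb c hc, hle _ hx' b hb c hc]
  · have e : cross u (c - a) = cross (x + u - a) (c - a) - cross (x - a) (c - a) := by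
      simp [cross]; ring
    rw [e]
    constructor <;> linarith [hl₁ x hx, hl₁ _ hx', hle a ha x hx c hc, hle a ha _ hx' c hc]
  · have e : cross u (b - a) = cross (b - a) (x - a) - cross (b - a) (x + u - a) := by
      simp [cross]; ring
    rw [e]
    constructor <;> linarith [hl₂ x hx, hl₂ _ hx', hle a ha b hb x hx, hle a ha b hb _ hx']

theorem mainTheorem8 :
    IsMinimalClosedConvexCovering (rotTransGroup 4) closedCurvesLengthTwo triangleBeta ∧
    IsSmallestAreaClosedConvexCovering translationGroup (unitSegments slopesA') triangleBeta := by
  refine ⟨isMinimalClosedConvexCovering_triangleBeta, isClosed_triangleBeta,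
    convex_triangleBeta, isCovering_triangleBeta_unitSegments, fun X hXc hX hcov => ?_⟩
  exact volume_triangleBeta_le.trans (volume_ge_of_isCovering hXc hX hcov)
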